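/- **Theorem (sequential and linear convergence of SPIRAL).** Let $n\ge 0$, $N\ge 1$, and consider the problem of minimizing $\varphi = \tfrac1N\sum_{i=1}^N f_i + g$ over $\mathbb R^n$ (with the Euclidean norm), where * each $h_i:\mathbb R^n\to\mathbb R$ is strictly convex and $f_i,h_i\in C^2(\mathbb R^n)$ with $\nabla^2 h_i\succ0$ everywhere; $f_i$ is $L_i$-smooth relative to $h_i$, i.e. $L_i\ge 0$ and $L_ih_i\pm f_i$ are convex; * $g:\mathbb R^n\to\mathbb R\cup\{+\infty\}$ is proper, lower semicontinuous and convex; * $\operatorname{argmin}\varphi\ne\emptyset$ and all sublevel sets $\{\varphi\le\alpha\}$, $\alpha\in\mathbb R$, are bounded; * $\varphi$ has the Kurdyka–Łojasiewicz property with exponent $\theta\in(0,1)$: for every $z^\star$ with $\partial\varphi(z^\star)\neq\emptyset$ there are $\eta,\epsilon,\rho>0$ such that $\psi'(\varphi(z)-\varphi(z^\star))\,\mathrm{dist}(0,\partial\varphi(z))\ge1$, with $\psi(s)=\rho s^{1-\theta}$, whenever $\|z-z^\star\|\le\epsilon$ and $\varphi(z^\star)<\varphi(z)<\varphi(z^\star)+\eta$.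 Here $\hat\partial\varphi$ and $\partial\varphi$ are the regular and the limiting subdifferential, and a point $z$ is *stationary* if $0\in\hat\partial\varphi(z)$. Let $\gamma_i\in(0,N/L_i)$ (any $\gamma_i>0$ if $L_i=0$), $\hat h_i=\tfrac1{\gamma_i}h_i-\tfrac1Nf_i$, $\hat h=\sum_{i=1}^N\hat h_i$, $D_{\hat h}(y,x)=\hat h(y)-\hat h(x)-\langle\nabla\hat h(x),y-x\rangle$, $\mathcal L(y,x)=\varphi(y)+D_{\hat h}(y,x)$ and $$T(s)=\operatorname*{argmin}_{w\in\mathbb R^n}\Big\{g(w)+\sum_{i=1}^N\tfrac1{\gamma_i}h_i(w)-\langle s,w\rangle\Big\}.$$ Let $\beta\in(0,1)$, $z^{\rm init}\in\mathbb R^n$, $s^0=\nabla\hat h(z^{\rm init})$, and let an infinite run of the algorithm SPIRAL be given: for $k=0,1,2,\dots$ 1. $z^k\in T(s^k)$ and $v^k\in T(\nabla\hat h(z^k))$; an update direction $d^k\in\mathbb R^n$ is chosen; 2. (linesearch) $\tau^k$ is the first of the numbers $1,\beta,\beta^2,\dots$ for which, with $u^k=z^k+(1-\tau^k)(v^k-z^k)+\tau^kd^k$,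 $\tilde s^k=\nabla\hat h(u^k)$ and $y^k\in T(\tilde s^k)$, one has $\mathcal L(y^k,u^k)\le\mathcal L(v^k,z^k)$; 3. (incremental loop) starting from $s=\tilde s^k$, the indices $i\in\{1,\dots,N\}$ are visited once each, in the order $1,\dots,N$ or in any other order, which may depend on $k$; at each visit one takes $\tilde z_i^k\in T(s)$ and replaces $s$ by $s+\nabla\hat h_i(\tilde z_i^k)-\nabla\hat h_i(u^k)$. The final value of $s$ is $s^{k+1}$. Suppose that for some $D\ge0$ the directions satisfy $\|d^k\|\le D\|z^k-v^k\|$ for all $k$. Then $(z^k)_{k\in\mathbb N}$ converges to a stationary point $z^\star$ of $\varphi$. If moreover $\theta\in(0,\tfrac12]$, then $(z^k)$ converges $R$-linearly to $z^\star$, all $\varphi(z^k)$ are finite, and $(\varphi(z^k))$ converges $R$-linearly to $\varphi(z^\star)$. ($(x^k)$ converges $R$-linearly to $x^\star$ if $\|x^k-x^\star\|\le\omega^k$ for all $k$ with scalars $\omega^k\ge0$ for which there are $\sigma\in(0,1)$ and $k_0$ with $\omega^{k+1}\le\sigma\omega^k$ for all $k\ge k_0$.) -/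

import Mathlib

open Filter Topology Set

namespace Spiral

noncomputable section

/-- Points of `ℝⁿ` with the Euclidean norm and inner product. -/
abbrev E (n : ℕ) : Type := EuclideanSpace ℝ (Fin n)

variable {n N : ℕ}

/-! ## Convex and variational analysis -/

/-- Distance-generating function: strictly convex and of class `C¹` on the whole space. -/
def IsDgf (h : E n → ℝ) : Prop :=
  StrictConvexOn ℝ univ h ∧ ContDiff ℝ 1 h

/-- The Bregman distance `D_h(y, x) = h(y) - h(x) - ⟨∇h(x), y - x⟩`. -/
def bregman (h : E n → ℝ) (y x : E n) : ℝ :=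
  h y - h x - inner ℝ (gradient h x) (y - x)

/-- `f` is `L`-smooth relative to `h`: `L ≥ 0` and both `L h + f` and `L h - f` are convex. -/
def IsRelSmooth (L : ℝ) (h f : E n → ℝ) : Prop :=
  0 ≤ L ∧ ConvexOn ℝ univ (fun x => L * h x + f x) ∧ ConvexOn ℝ univ (fun x => L * h x - f x)

/-- The Hessian `∇²h(x)`, as the derivative of the gradient field. -/
def hessian (h : E n → ℝ) (x : E n) : E n →L[ℝ] E n :=
  fderiv ℝ (gradient h) x

/-- `∇²h ≻ 0` at every point. -/
def HessianPosDef (h : E n → ℝ) : Prop :=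
  ∀ x w : E n, w ≠ 0 → 0 < inner ℝ (hessian h x w) w

/-- A function with values in `ℝ ∪ {+∞}` which is not identically `+∞`. -/
def IsProper (φ : E n → EReal) : Prop :=
  (∀ x, φ x ≠ ⊥) ∧ ∃ x, φ x ≠ ⊤

/-- Convexity of an extended-real-valued function: its epigraph is convex. -/
def IsConvexFun (φ : E n → EReal) : Prop :=
  Convex ℝ {p : E n × ℝ | φ p.1 ≤ (p.2 : EReal)}

/-- All sublevel sets at real levels are bounded. -/
def IsLevelBounded (φ : E n → EReal) : Prop :=
  ∀ α : ℝ, Bornology.IsBounded {x | φ x ≤ (α : EReal)}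

/-- The set of global minimizers. -/
def argmin (φ : E n → EReal) : Set (E n) :=
  {w | ∀ w', φ w ≤ φ w'}

/-- The regular (Fréchet) subdifferential; it is empty outside the points where `φ` is finite. -/
def regSubdiff (φ : E n → EReal) (x : E n) : Set (E n) :=
  {v | φ x ≠ ⊤ ∧ φ x ≠ ⊥ ∧
    0 ≤ liminf (fun y : E n =>
      (φ y - φ x - ((inner ℝ v (y - x) : ℝ) : EReal)) / ((‖y - x‖ : ℝ) : EReal)) (𝓝[≠] x)}

/-- The limiting subdifferential. -/
def subdiff (φ : E n → EReal) (x : E n) : Set (E n) :=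
  {v | φ x ≠ ⊤ ∧ φ x ≠ ⊥ ∧ ∃ (xs vs : ℕ → E n),
    (∀ k, vs k ∈ regSubdiff φ (xs k)) ∧ Tendsto xs atTop (𝓝 x) ∧
    Tendsto (fun k => φ (xs k)) atTop (𝓝 (φ x)) ∧ Tendsto vs atTop (𝓝 v)}

/-- `x` is stationary for `φ`: `0` is a regular subgradient at `x`. -/
def IsStationary (φ : E n → EReal) (x : E n) : Prop :=
  (0 : E n) ∈ regSubdiff φ x

/-- The desingularizing function `ψ(s) = ρ s ^ (1 - θ)`. -/
def desing (ρ θ : ℝ) (s : ℝ) : ℝ := ρ * s ^ (1 - θ)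

/-- The Kurdyka–Łojasiewicz property with exponent `θ`, at every point of `dom ∂φ`. The distance
of `0` to the empty set is `+∞`. -/
def HasKL (φ : E n → EReal) (θ : ℝ) : Prop :=
  ∀ zs : E n, (subdiff φ zs).Nonempty → ∃ η ε ρ : ℝ, 0 < η ∧ 0 < ε ∧ 0 < ρ ∧
    ∀ z : E n, ‖z - zs‖ ≤ ε → φ zs < φ z → φ z < φ zs + (η : EReal) →
      1 ≤ ENNReal.ofReal (deriv (desing ρ θ) (φ z - φ zs).toReal) *
        Metric.infEDist (0 : E n) (subdiff φ z)

/-! ## Rates of convergence -/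

/-- `x` converges `Q`-linearly to `a`. -/
def QLinear {X : Type*} [PseudoMetricSpace X] (x : ℕ → X) (a : X) : Prop :=
  ∃ σ : ℝ, 0 < σ ∧ σ < 1 ∧ ∃ k₀ : ℕ, ∀ k, k₀ ≤ k → dist (x (k + 1)) a ≤ σ * dist (x k) a

/-- `x` converges `R`-linearly to `a`. -/
def RLinear {X : Type*} [PseudoMetricSpace X] (x : ℕ → X) (a : X) : Prop :=
  ∃ v : ℕ → ℝ, (∀ k, 0 ≤ v k) ∧ (∀ k, dist (x k) a ≤ v k) ∧ QLinear v 0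

/-! ## The finite sum problem and its oracles -/

/-- The cost `φ = (1/N) ∑ f_i + g`. -/
def cost (f : Fin N → E n → ℝ) (g : E n → EReal) (z : E n) : EReal :=
  (((1 / (N : ℝ)) * ∑ i, f i z : ℝ) : EReal) + g z

/-- `ĥ_i = h_i / γ_i - f_i / N`. -/
def hHatI (f h : Fin N → E n → ℝ) (γ : Fin N → ℝ) (i : Fin N) (x : E n) : ℝ :=
  (1 / γ i) * h i x - (1 / (N : ℝ)) * f i x

/-- `ĥ = ∑ ĥ_i`. -/
def hHat (f h : Fin N → E n → ℝ) (γ : Fin N → ℝ) (x : E n) : ℝ :=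
  ∑ i, hHatI f h γ i x

/-- The oracle `T(s) = argmin_w { g(w) + ∑ h_i(w) / γ_i - ⟨s, w⟩ }`. -/
def oracle (h : Fin N → E n → ℝ) (g : E n → EReal) (γ : Fin N → ℝ) (s : E n) : Set (E n) :=
  argmin fun w => g w + ((∑ i, (1 / γ i) * h i w - inner ℝ s w : ℝ) : EReal)

/-- The Lyapunov function `ℒ(y, x) = φ(y) + D_ĥ(y, x)`, used with `y ∈ T(∇ĥ(x))`. -/
def lyapunov (f h : Fin N → E n → ℝ) (g : E n → EReal) (γ : Fin N → ℝ) (y x : E n) : EReal :=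
  cost f g y + (bregman (hHat f h γ) y x : EReal)

/-- An infinite run of the algorithm SPIRAL from the point `zInit` with backtracking factor `β`.
In the `k`-th outer iteration `u k j`, `sTilde k j`, `y k j` belong to the `j`-th linesearch trial,
with stepsize `β ^ j`; the trial number `m k` is the first one to be accepted. In the incremental
loop the indices are swept in the order `perm k 0, …, perm k (N - 1)` (the identity for the cyclic
rule, any permutation for the shuffled cyclic one), and `sInner k i` is the value of the vector `s`
after `i` incremental steps. -/
structure Run (f h : Fin N → E n → ℝ) (g : E n → EReal) (γ : Fin N → ℝ) (β : ℝ)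
    (zInit : E n) where
  s : ℕ → E n
  z : ℕ → E n
  v : ℕ → E n
  d : ℕ → E n
  m : ℕ → ℕ
  u : ℕ → ℕ → E n
  sTilde : ℕ → ℕ → E n
  y : ℕ → ℕ → E n
  perm : ℕ → Equiv.Perm (Fin N)
  sInner : ℕ → Fin (N + 1) → E n
  zTilde : ℕ → Fin N → E n
  s_zero : s 0 = gradient (hHat f h γ) zInit
  z_mem : ∀ k, z k ∈ oracle h g γ (s k)
  v_mem : ∀ k, v k ∈ oracle h g γ (gradient (hHat f h γ) (z k))
  u_eq : ∀ k, ∀ j ≤ m k, u k j = z k + (1 - β ^ j) • (v k - z k) + β ^ j • d k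
  sTilde_eq : ∀ k, ∀ j ≤ m k, sTilde k j = gradient (hHat f h γ) (u k j)
  y_mem : ∀ k, ∀ j ≤ m k, y k j ∈ oracle h g γ (sTilde k j)
  ls_reject : ∀ k, ∀ j < m k,
    lyapunov f h g γ (v k) (z k) < lyapunov f h g γ (y k j) (u k j)
  ls_accept : ∀ k, lyapunov f h g γ (y k (m k)) (u k (m k)) ≤ lyapunov f h g γ (v k) (z k)
  sInner_zero : ∀ k, sInner k 0 = sTilde k (m k)
  zTilde_mem : ∀ k i, zTilde k i ∈ oracle h g γ (sInner k i.castSucc)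
  sInner_succ : ∀ k i, sInner k i.succ = sInner k i.castSucc +
    (gradient (hHatI f h γ (perm k i)) (zTilde k i)
      - gradient (hHatI f h γ (perm k i)) (u k (m k)))
  s_succ : ∀ k, s (k + 1) = sInner k (Fin.last N)

end

end Spiral

/-!
The cost `φ = F + g`, with `F = (1/N) ∑ f_i`, is itself a Lyapunov function of the outer iteration.
Write `K = ∑ h_i / γ_i = F + ĥ`; then `T(s)` minimizes `φ + ĥ - ⟨s, ·⟩`, and its optimality condition
(`oracle_subgradient`) says that `s - ∇K(w)` is a convex subgradient of `g` at `w ∈ T(s)`. Two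
consequences carry the descent. First, `ℒ(v, z) + D_K(z, v) ≤ φ(z)` for `v ∈ T(∇ĥ(z))`
(`lyapunov_add_bregman_le`). Secondly, after some incremental steps the oracle minimizes
`φ + ∑ D_{ĥ_i}(·, p_i)`, where `p_i` is `z̃_i` for the visited indices and `u` for the others; moving
a base point to the current minimizer lowers the minimum by at least `D_{ĥ_i}(z̃_i, u)`
(`loop_descent`).
Together with the linesearch test,
`φ(z⁺) + ∑ (D_{ĥ_i}(z⁺, z̃_i) + D_{ĥ_i}(z̃_i, u)) + D_K(z, v) ≤ φ(z)` (`Run.value_succ_add_le`).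

All iterates therefore stay in a sublevel set of `φ`, hence in a ball. There the Bregman distances
dominate squared Euclidean distances and the gradients `∇ĥ_i` are Lipschitz, which gives, with an
increment `Δ_k`, the estimates `φ(z^{k+1}) + a Δ_k² ≤ φ(z^k)`, `‖z^{k+1} - z^k‖ ≤ b Δ_k` and
`‖ξ^{k+1}‖ ≤ c Δ_k` for a subgradient `ξ^{k+1}` of `φ` at `z^{k+1}` (`Run.exists_estimates`). The bound
on the directions enters only through `‖u - z‖ ≤ (1 + D) ‖z - v‖`. By lower semicontinuity of `g` and
the subgradient inequality, a cluster point `z⋆` is stationary and `φ(z^k)` decreases to `φ(z⋆)`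
(`Run.stationary_of_tendsto`).

With `e_k = φ(z^k) - φ(z⋆)` and `ψ(s) = s^{1-θ}`, the Kurdyka–Łojasiewicz inequality and the concavity
of `ψ` yield `2Δ_{k+1} ≤ Δ_k + C (ψ(e_{k+1}) - ψ(e_{k+2}))` near `z⋆`. Hence
`‖z^{k+1} - z⋆‖ + b (Δ_k + C ψ(e_{k+1}))` is nonincreasing as long as `z^{k+1}` stays near `z⋆`; as it
becomes arbitrarily small along a subsequence, the whole sequence converges (`tendsto_of_kl`). If
`θ ≤ 1/2`, the same inequality gives `e_{k+1} ≤ C (e_k - e_{k+1})`, so `e` contracts, and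
`‖z^k - z⋆‖ ≤ M √(e_k)` (`eventually_contraction_of_kl`, `eventually_dist_le_sqrt`).
-/

namespace Spiral

/-! ### Gradients, Bregman distances and relative smoothness -/

section Analysis

variable {n : ℕ}

lemma contDiff_gradient {h : E n → ℝ} (hh : ContDiff ℝ 2 h) : ContDiff ℝ 1 (gradient h) := by
  -- Over `ℝ` the conjugate-linear Riesz map is linear.
  let A : StrongDual ℝ (E n) →ₗ[ℝ] E n :=
    { toFun := fun l => (InnerProductSpace.toDual ℝ (E n)).symm l
      map_add' := fun a b => map_add _ a b
      map_smul' := fun c a => by simp }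
  have h1 : ContDiff ℝ 1 (fderiv ℝ h) := hh.fderiv_right (by norm_num)
  exact (LinearMap.toContinuousLinearMap A).contDiff.comp h1

lemma hasDerivAt_comp_lineMap {h : E n → ℝ} (hh : Differentiable ℝ h) (x y : E n) (t : ℝ) :
    HasDerivAt (fun t : ℝ => h (AffineMap.lineMap x y t))
      (inner ℝ (gradient h (AffineMap.lineMap x y t)) (y - x)) t := by
  rw [inner_gradient_left]
  exact (hh _).hasFDerivAt.comp_hasDerivAt t AffineMap.hasDerivAt_lineMap

lemma bregman_eq_fderiv (h : E n → ℝ) (y x : E n) :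
    bregman h y x = h y - h x - fderiv ℝ h x (y - x) := by
  rw [bregman, inner_gradient_left]

lemma bregman_self (h : E n → ℝ) (x : E n) : bregman h x x = 0 := by
  simp [bregman]

lemma bregman_nonneg {h : E n → ℝ} (hc : ConvexOn ℝ univ h) (hh : Differentiable ℝ h)
    (y x : E n) : 0 ≤ bregman h y x := by
  have h1 : ConvexOn ℝ univ (fun t : ℝ => h (AffineMap.lineMap x y t)) := by
    exact hc.comp_affineMap (AffineMap.lineMap (k := ℝ) x y)
  have h2 := h1.le_slope_of_hasDerivAt (mem_univ 0) (mem_univ 1) zero_lt_one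
    (hasDerivAt_comp_lineMap hh x y 0)
  simp [slope] at h2
  simp [bregman]
  linarith

/-- A Hessian that is positive definite everywhere is uniformly so on a ball, by compactness of the
product of the ball with the unit sphere. -/
lemma exists_hessian_ge {h : E n → ℝ} (hh : ContDiff ℝ 2 h) (hpos : HessianPosDef h) (r : ℝ) :
    ∃ μ : ℝ, 0 < μ ∧ ∀ x ∈ Metric.closedBall (0 : E n) r, ∀ w : E n,
      μ * ‖w‖ ^ 2 ≤ inner ℝ (hessian h x w) w := by
  have hcont : Continuous fun p : E n × E n => inner ℝ (hessian h p.1 p.2) p.2 := by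
    have h1 : Continuous (hessian h) := (contDiff_gradient hh).continuous_fderiv (by norm_num)
    exact ((h1.comp continuous_fst).clm_apply continuous_snd).inner continuous_snd
  have hcpt : IsCompact (Metric.closedBall (0 : E n) r ×ˢ Metric.sphere (0 : E n) 1) :=
    (isCompact_closedBall _ _).prod (isCompact_sphere _ _)
  obtain ⟨μ, hμ0, hμ⟩ : ∃ μ : ℝ, 0 < μ ∧
      ∀ p ∈ Metric.closedBall (0 : E n) r ×ˢ Metric.sphere (0 : E n) 1,
        μ ≤ inner ℝ (hessian h p.1 p.2) p.2 := by
    rcases (Metric.closedBall (0 : E n) r ×ˢ Metric.sphere (0 : E n) 1).eq_empty_or_nonempty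
      with he | hne
    · exact ⟨1, one_pos, by simp [he]⟩
    · obtain ⟨p, hp, hmin⟩ := hcpt.exists_isMinOn hne hcont.continuousOn
      refine ⟨_, hpos p.1 p.2 ?_, fun q hq => hmin hq⟩
      intro h0
      have := hp.2
      simp [h0] at this
  refine ⟨μ, hμ0, fun x hx w => ?_⟩
  rcases eq_or_ne w 0 with rfl | hw
  · simp
  have hn : ‖w‖ ≠ 0 := norm_ne_zero_iff.2 hw
  have h1 := hμ (x, ‖w‖⁻¹ • w) ⟨hx, by simp [norm_smul, hn]⟩
  simp only [map_smul, inner_smul_left, inner_smul_right, conj_trivial] at h1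
  calc μ * ‖w‖ ^ 2 ≤ (‖w‖⁻¹ * (‖w‖⁻¹ * inner ℝ (hessian h x w) w)) * ‖w‖ ^ 2 := by gcongr
    _ = inner ℝ (hessian h x w) w := by field_simp

/-- A `C²` function with positive definite Hessian is strongly convex on balls, expressed through
its Bregman distance. -/
lemma exists_bregman_ge {h : E n → ℝ} (hh : ContDiff ℝ 2 h) (hpos : HessianPosDef h) (r : ℝ) :
    ∃ μ : ℝ, 0 < μ ∧ ∀ x ∈ Metric.closedBall (0 : E n) r, ∀ y ∈ Metric.closedBall (0 : E n) r,
      μ * ‖y - x‖ ^ 2 ≤ bregman h y x := by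
  obtain ⟨μ, hμ0, hμ⟩ := exists_hessian_ge hh hpos r
  refine ⟨μ / 2, by positivity, fun x hx y hy => ?_⟩
  have hdiff : Differentiable ℝ h := hh.differentiable (by norm_num)
  have hgdiff : Differentiable ℝ (gradient h) :=
    (contDiff_gradient hh).differentiable (by norm_num)
  let l : ℝ → E n := fun t => AffineMap.lineMap x y t
  have hl : ∀ t ∈ Icc (0 : ℝ) 1, l t ∈ Metric.closedBall (0 : E n) r := fun t ht =>
    (convex_closedBall (0 : E n) r).lineMap_mem hx hy ht
  -- `q` is the derivative of `p`, and `q'` is nonnegative by the Hessian bound.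
  let q : ℝ → ℝ := fun t => inner ℝ (gradient h (l t)) (y - x) - μ * ‖y - x‖ ^ 2 * t
  have hq : ∀ t, HasDerivAt q
      (inner ℝ (hessian h (l t) (y - x)) (y - x) - μ * ‖y - x‖ ^ 2) t := by
    intro t
    have h1 : HasDerivAt (fun t => gradient h (l t)) (hessian h (l t) (y - x)) t :=
      (hgdiff _).hasFDerivAt.comp_hasDerivAt t AffineMap.hasDerivAt_lineMap
    have h2 := h1.inner ℝ (hasDerivAt_const t (y - x))
    have h3 := (hasDerivAt_id t).const_mul (μ * ‖y - x‖ ^ 2)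
    refine (h2.sub h3).congr_deriv ?_
    simp
  have hqmono : MonotoneOn q (Icc 0 1) := by
    refine monotoneOn_of_deriv_nonneg (convex_Icc 0 1)
      (fun t _ => (hq t).continuousAt.continuousWithinAt)
      (fun t _ => (hq t).differentiableAt.differentiableWithinAt) fun t ht => ?_
    rw [(hq t).deriv]
    rw [interior_Icc] at ht
    linarith [hμ (l t) (hl t (Ioo_subset_Icc_self ht)) (y - x)]
  let p : ℝ → ℝ := fun t =>
    h (l t) - inner ℝ (gradient h x) (y - x) * t - μ * ‖y - x‖ ^ 2 / 2 * t ^ 2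
  have hp : ∀ t, HasDerivAt p (q t - inner ℝ (gradient h x) (y - x)) t := by
    intro t
    have h1 := hasDerivAt_comp_lineMap hdiff x y t
    have h2 := (hasDerivAt_id t).const_mul (inner ℝ (gradient h x) (y - x))
    have h3 := (hasDerivAt_pow 2 t).const_mul (μ * ‖y - x‖ ^ 2 / 2)
    refine ((h1.sub h2).sub h3).congr_deriv ?_
    simp only [q, l]
    push_cast
    ring
  have hpmono : MonotoneOn p (Icc 0 1) := by
    refine monotoneOn_of_deriv_nonneg (convex_Icc 0 1)
      (fun t _ => (hp t).continuousAt.continuousWithinAt)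
      (fun t _ => (hp t).differentiableAt.differentiableWithinAt) fun t ht => ?_
    rw [(hp t).deriv]
    rw [interior_Icc] at ht
    have h1 := hqmono (left_mem_Icc.2 zero_le_one) (Ioo_subset_Icc_self ht) ht.1.le
    simp only [q, l, AffineMap.lineMap_apply_zero, mul_zero, sub_zero] at h1
    simp only [q, l]
    linarith
  have h1 := hpmono (left_mem_Icc.2 zero_le_one) (right_mem_Icc.2 zero_le_one) zero_le_one
  simp only [p, l, AffineMap.lineMap_apply_zero, AffineMap.lineMap_apply_one] at h1
  rw [bregman]
  linarith

lemma exists_gradient_lipschitz {h : E n → ℝ} (hh : ContDiff ℝ 2 h) (r : ℝ) :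
    ∃ C : ℝ, 0 ≤ C ∧ ∀ x ∈ Metric.closedBall (0 : E n) r,
      ∀ y ∈ Metric.closedBall (0 : E n) r,
      ‖gradient h x - gradient h y‖ ≤ C * ‖x - y‖ := by
  obtain ⟨C, hC⟩ := LocallyLipschitzOn.exists_lipschitzOnWith_of_compact
    (isCompact_closedBall (0 : E n) r) ((contDiff_gradient hh).locallyLipschitz.locallyLipschitzOn)
  exact ⟨C, C.2, fun x hx y hy => by simpa [dist_eq_norm] using hC.dist_le_mul x hx y hy⟩

end Analysis

/-! ### The functions of the finite sum problem -/

section FiniteSum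

variable {n N : ℕ} {f h : Fin N → E n → ℝ} {g : E n → EReal} {γ L : Fin N → ℝ}

/-- The smooth part `(1/N) ∑ f_i` of the cost. -/
noncomputable def smoothPart (f : Fin N → E n → ℝ) (x : E n) : ℝ :=
  (1 / (N : ℝ)) * ∑ i, f i x

/-- The distance-generating function `∑ h_i / γ_i` of the oracle. -/
noncomputable def oracleDgf (h : Fin N → E n → ℝ) (γ : Fin N → ℝ) (x : E n) : ℝ :=
  ∑ i, (1 / γ i) * h i x

lemma smoothPart_add_hHat (f h : Fin N → E n → ℝ) (γ : Fin N → ℝ) (x : E n) :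
    smoothPart f x + hHat f h γ x = oracleDgf h γ x := by
  simp [smoothPart, hHat, hHatI, oracleDgf, Finset.sum_sub_distrib, Finset.mul_sum]

lemma contDiff_smoothPart (hf : ∀ i, ContDiff ℝ 2 (f i)) : ContDiff ℝ 2 (smoothPart f) :=
  contDiff_const.mul (ContDiff.sum fun i _ => hf i)

lemma contDiff_oracleDgf (hh : ∀ i, ContDiff ℝ 2 (h i)) : ContDiff ℝ 2 (oracleDgf h γ) :=
  ContDiff.sum fun i _ => contDiff_const.mul (hh i)

lemma contDiff_hHatI (hf : ∀ i, ContDiff ℝ 2 (f i)) (hh : ∀ i, ContDiff ℝ 2 (h i)) (i : Fin N) :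
    ContDiff ℝ 2 (hHatI f h γ i) :=
  (contDiff_const.mul (hh i)).sub (contDiff_const.mul (hf i))

lemma contDiff_hHat (hf : ∀ i, ContDiff ℝ 2 (f i)) (hh : ∀ i, ContDiff ℝ 2 (h i)) :
    ContDiff ℝ 2 (hHat f h γ) :=
  ContDiff.sum fun i _ => contDiff_hHatI hf hh i

lemma gradient_hHat (hf : ∀ i, ContDiff ℝ 2 (f i)) (hh : ∀ i, ContDiff ℝ 2 (h i)) (x : E n) :
    gradient (hHat f h γ) x = ∑ i, gradient (hHatI f h γ i) x := by
  have h1 : fderiv ℝ (hHat f h γ) x = ∑ i, fderiv ℝ (hHatI f h γ i) x :=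
    fderiv_fun_sum fun i _ => ((contDiff_hHatI hf hh i).differentiable (by norm_num)) x
  simp only [gradient, h1, map_sum]

lemma gradient_oracleDgf (hf : ∀ i, ContDiff ℝ 2 (f i)) (hh : ∀ i, ContDiff ℝ 2 (h i))
    (x : E n) : gradient (oracleDgf h γ) x =
      gradient (smoothPart f) x + gradient (hHat f h γ) x := by
  have h1 : oracleDgf h γ = fun x => smoothPart f x + hHat f h γ x :=
    funext fun x => (smoothPart_add_hHat f h γ x).symm
  have h2 := fderiv_fun_add (((contDiff_smoothPart hf).differentiable (by norm_num)) x)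
    (((contDiff_hHat (γ := γ) hf hh).differentiable (by norm_num)) x)
  rw [← h1] at h2
  simp only [gradient, h2, map_add]

lemma bregman_hHat (hf : ∀ i, ContDiff ℝ 2 (f i)) (hh : ∀ i, ContDiff ℝ 2 (h i)) (y x : E n) :
    bregman (hHat f h γ) y x = ∑ i, bregman (hHatI f h γ i) y x := by
  simp only [bregman, gradient_hHat hf hh, sum_inner, Finset.sum_sub_distrib]
  rfl

lemma bregman_oracleDgf (hh : ∀ i, ContDiff ℝ 2 (h i)) (y x : E n) :
    bregman (oracleDgf h γ) y x = ∑ i, (1 / γ i) * bregman (h i) y x := by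
  have hd : ∀ i, DifferentiableAt ℝ (h i) x := fun i => (hh i).differentiable (by norm_num) x
  have h1 : fderiv ℝ (oracleDgf h γ) x = ∑ i, (1 / γ i) • fderiv ℝ (h i) x := by
    refine (fderiv_fun_sum fun i _ => (hd i).const_mul _).trans ?_
    exact Finset.sum_congr rfl fun i _ => fderiv_const_mul (hd i) _
  simp only [bregman_eq_fderiv, h1, mul_sub, Finset.sum_sub_distrib, oracleDgf]
  simp

/-- Relative smoothness makes `ĥ_i - c h_i` convex for `c = 1/γ_i - L_i/N`, so that `ĥ_i` inherits
the strong convexity of `h_i`. -/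
lemma bregman_hHatI_ge (hN : 0 < N) (hsmooth : ∀ i, IsRelSmooth (L i) (h i) (f i))
    (hf : ∀ i, ContDiff ℝ 2 (f i)) (hh : ∀ i, ContDiff ℝ 2 (h i)) (i : Fin N) (y x : E n) :
    (1 / γ i - L i / N) * bregman (h i) y x ≤ bregman (hHatI f h γ i) y x := by
  have hfd : Differentiable ℝ (f i) := (hf i).differentiable (by norm_num)
  have hhd : Differentiable ℝ (h i) := (hh i).differentiable (by norm_num)
  have h0 := bregman_nonneg (hsmooth i).2.2 ((hhd.const_mul _).sub hfd) y x
  have h1 : fderiv ℝ (fun x => L i * h i x - f i x) x = L i • fderiv ℝ (h i) x - fderiv ℝ (f i) x :=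
    (fderiv_fun_sub ((hhd x).const_mul _) (hfd x)).trans (by rw [fderiv_const_mul (hhd x)])
  have h2 : fderiv ℝ (hHatI f h γ i) x =
      (1 / γ i) • fderiv ℝ (h i) x - (1 / (N : ℝ)) • fderiv ℝ (f i) x :=
    (fderiv_fun_sub ((hhd x).const_mul _) ((hfd x).const_mul _)).trans
      (by rw [fderiv_const_mul (hhd x), fderiv_const_mul (hfd x)])
  have hN' : (0 : ℝ) < N := by exact_mod_cast hN
  simp only [bregman_eq_fderiv, h1, h2, hHatI] at h0 ⊢
  simp only [_root_.sub_apply, _root_.smul_apply, smul_eq_mul] at h0 ⊢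
  have h3 := mul_nonneg (one_div_pos.2 hN').le h0
  rw [div_eq_mul_one_div (L i)]
  linarith

lemma dgf_coeff_pos (hN : 0 < N) (hγ0 : ∀ i, 0 < γ i) (hγL : ∀ i, γ i * L i < (N : ℝ))
    (i : Fin N) : 0 < 1 / γ i - L i / N := by
  have hN' : (0 : ℝ) < N := by exact_mod_cast hN
  rw [sub_pos, div_lt_div_iff₀ hN' (hγ0 i)]
  linarith [hγL i]

/-- On a ball, all the Bregman distances of the algorithm dominate one multiple of the squared
Euclidean distance. -/
lemma exists_bregman_ge_uniform (hN : 0 < N) (hdgf : ∀ i, IsDgf (h i))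
    (hsmooth : ∀ i, IsRelSmooth (L i) (h i) (f i))
    (hf : ∀ i, ContDiff ℝ 2 (f i)) (hh : ∀ i, ContDiff ℝ 2 (h i))
    (hpos : ∀ i, HessianPosDef (h i)) (hγ0 : ∀ i, 0 < γ i) (hγL : ∀ i, γ i * L i < (N : ℝ))
    (r : ℝ) : ∃ a : ℝ, 0 < a ∧ ∀ x ∈ Metric.closedBall (0 : E n) r,
      ∀ y ∈ Metric.closedBall (0 : E n) r, a * ‖y - x‖ ^ 2 ≤ bregman (oracleDgf h γ) y x ∧
        ∀ i, a * ‖y - x‖ ^ 2 ≤ bregman (hHatI f h γ i) y x := by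
  choose μ hμ0 hμ using fun i => exists_bregman_ge (hh i) (hpos i) r
  have hne : (Finset.univ : Finset (Fin N)).Nonempty := ⟨⟨0, hN⟩, Finset.mem_univ _⟩
  let b : Fin N → ℝ := fun i => (1 / γ i - L i / N) * μ i
  have hb0 : ∀ i, 0 < b i := fun i => mul_pos (dgf_coeff_pos hN hγ0 hγL i) (hμ0 i)
  obtain ⟨j, -, hj⟩ := Finset.exists_min_image Finset.univ b hne
  refine ⟨b j, hb0 j, fun x hx y hy => ?_⟩
  have hI : ∀ i, b j * ‖y - x‖ ^ 2 ≤ (1 / γ i - L i / N) * bregman (h i) y x := fun i =>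
    calc b j * ‖y - x‖ ^ 2 ≤ b i * ‖y - x‖ ^ 2 := by gcongr; exact hj i (Finset.mem_univ i)
      _ = (1 / γ i - L i / N) * (μ i * ‖y - x‖ ^ 2) := by ring
      _ ≤ _ := mul_le_mul_of_nonneg_left (hμ i x hx y hy) (dgf_coeff_pos hN hγ0 hγL i).le
  have hbn : ∀ i, 0 ≤ bregman (h i) y x := fun i =>
    bregman_nonneg (hdgf i).1.convexOn ((hh i).differentiable (by norm_num)) y x
  refine ⟨?_, fun i => (hI i).trans (bregman_hHatI_ge hN hsmooth hf hh i y x)⟩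
  rw [bregman_oracleDgf hh]
  have hLN : 0 ≤ L j / N := div_nonneg (hsmooth j).1 (Nat.cast_nonneg N)
  calc b j * ‖y - x‖ ^ 2 ≤ (1 / γ j - L j / N) * bregman (h j) y x := hI j
    _ ≤ (1 / γ j) * bregman (h j) y x := by
        gcongr
        · exact hbn j
        · linarith
    _ ≤ _ := Finset.single_le_sum
        (f := fun i => (1 / γ i) * bregman (h i) y x)
        (fun i _ => mul_nonneg (one_div_pos.2 (hγ0 i)).le (hbn i)) (Finset.mem_univ j)

lemma bregman_hHatI_nonneg (hN : 0 < N) (hdgf : ∀ i, IsDgf (h i))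
    (hsmooth : ∀ i, IsRelSmooth (L i) (h i) (f i))
    (hf : ∀ i, ContDiff ℝ 2 (f i)) (hh : ∀ i, ContDiff ℝ 2 (h i))
    (hγ0 : ∀ i, 0 < γ i) (hγL : ∀ i, γ i * L i < (N : ℝ)) (i : Fin N) (y x : E n) :
    0 ≤ bregman (hHatI f h γ i) y x :=
  (mul_nonneg (dgf_coeff_pos hN hγ0 hγL i).le
    (bregman_nonneg (hdgf i).1.convexOn ((hh i).differentiable (by norm_num)) y x)).trans
    (bregman_hHatI_ge hN hsmooth hf hh i y x)

lemma exists_gradient_hHatI_lipschitz (hf : ∀ i, ContDiff ℝ 2 (f i))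
    (hh : ∀ i, ContDiff ℝ 2 (h i)) (r : ℝ) :
    ∃ C : ℝ, 0 ≤ C ∧ ∀ i, ∀ x ∈ Metric.closedBall (0 : E n) r,
      ∀ y ∈ Metric.closedBall (0 : E n) r,
      ‖gradient (hHatI f h γ i) x - gradient (hHatI f h γ i) y‖ ≤ C * ‖x - y‖ := by
  choose C hC0 hC using fun i => exists_gradient_lipschitz (contDiff_hHatI (γ := γ) hf hh i) r
  refine ⟨∑ i, C i, Finset.sum_nonneg fun i _ => hC0 i, fun i x hx y hy => ?_⟩
  refine (hC i x hx y hy).trans ?_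
  gcongr
  exact Finset.single_le_sum (f := C) (fun i _ => hC0 i) (Finset.mem_univ i)

end FiniteSum

/-! ### The oracle and the subgradients it produces -/

section Oracle

variable {n N : ℕ} {f h : Fin N → E n → ℝ} {g : E n → EReal} {γ : Fin N → ℝ}

lemma coe_toReal_of_isProper (hg : IsProper g) {w : E n} (hw : g w ≠ ⊤) :
    ((g w).toReal : EReal) = g w :=
  EReal.coe_toReal hw (hg.1 w)

lemma cost_eq_coe (hg : IsProper g) {w : E n} (hw : g w ≠ ⊤) :
    cost f g w = ((smoothPart f w + (g w).toReal : ℝ) : EReal) := by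
  rw [EReal.coe_add, coe_toReal_of_isProper hg hw]
  rfl

lemma toReal_cost (hg : IsProper g) {w : E n} (hw : g w ≠ ⊤) :
    (cost f g w).toReal = smoothPart f w + (g w).toReal := by
  rw [cost_eq_coe hg hw, EReal.toReal_coe]

lemma ne_top_of_mem_oracle (hg : IsProper g) {s w : E n} (hw : w ∈ oracle h g γ s) :
    g w ≠ ⊤ := by
  obtain ⟨x, hx⟩ := hg.2
  intro htop
  have h1 := hw x
  dsimp only at h1
  rw [htop, EReal.top_add_coe, ← coe_toReal_of_isProper hg hx, ← EReal.coe_add, top_le_iff] at h1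
  exact EReal.coe_ne_top _ h1

lemma oracle_le (hg : IsProper g) {s w x : E n} (hw : w ∈ oracle h g γ s) (hx : g x ≠ ⊤) :
    (g w).toReal + oracleDgf h γ w - inner ℝ s w ≤
      (g x).toReal + oracleDgf h γ x - inner ℝ s x := by
  have h1 := hw x
  dsimp only at h1
  rw [← coe_toReal_of_isProper hg hx, ← coe_toReal_of_isProper hg (ne_top_of_mem_oracle hg hw),
    ← EReal.coe_add, ← EReal.coe_add, EReal.coe_le_coe_iff] at h1
  simp only [oracleDgf]
  linarith

lemma convex_combination_le (hg : IsProper g) (hc : IsConvexFun g) {w x : E n} (hw : g w ≠ ⊤)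
    (hx : g x ≠ ⊤) {t : ℝ} (ht : t ∈ Icc (0 : ℝ) 1) :
    g (AffineMap.lineMap w x t) ≠ ⊤ ∧
      (g (AffineMap.lineMap w x t)).toReal ≤ (g w).toReal + t * ((g x).toReal - (g w).toReal) := by
  have h1 : ((w, (g w).toReal) : E n × ℝ) ∈ {p : E n × ℝ | g p.1 ≤ (p.2 : EReal)} :=
    (coe_toReal_of_isProper hg hw).ge
  have h2 : ((x, (g x).toReal) : E n × ℝ) ∈ {p : E n × ℝ | g p.1 ≤ (p.2 : EReal)} :=
    (coe_toReal_of_isProper hg hx).ge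
  have h3 := hc.lineMap_mem h1 h2 ht
  have h4 : g (AffineMap.lineMap w x t) ≤
      (((g w).toReal + t * ((g x).toReal - (g w).toReal) : ℝ) : EReal) := by
    simpa [AffineMap.lineMap_apply, add_comm] using h3
  have h5 : g (AffineMap.lineMap w x t) ≠ ⊤ := ne_top_of_le_ne_top (EReal.coe_ne_top _) h4
  refine ⟨h5, ?_⟩
  rwa [← coe_toReal_of_isProper hg h5, EReal.coe_le_coe_iff] at h4

/-- The optimality condition of the oracle: `s - ∇(∑ h_i / γ_i)(w)` is a convex subgradient of `g`
at `w ∈ T(s)`. -/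
lemma oracle_subgradient (hg : IsProper g) (hc : IsConvexFun g)
    (hh : ∀ i, ContDiff ℝ 2 (h i)) {s w x : E n} (hw : w ∈ oracle h g γ s) (hx : g x ≠ ⊤) :
    (g w).toReal + inner ℝ (s - gradient (oracleDgf h γ) w) (x - w) ≤ (g x).toReal := by
  have hwt := ne_top_of_mem_oracle hg hw
  -- Along the segment, the difference quotient of the smooth part at `0` is bounded below.
  have hder : HasDerivAt
      (fun t : ℝ => oracleDgf h γ (AffineMap.lineMap w x t) - inner ℝ s (x - w) * t)
      (inner ℝ (gradient (oracleDgf h γ) w) (x - w) - inner ℝ s (x - w)) 0 := by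
    have h1 := hasDerivAt_comp_lineMap
      ((contDiff_oracleDgf (γ := γ) hh).differentiable (by norm_num)) w x 0
    have h2 := (hasDerivAt_id (0 : ℝ)).const_mul (inner ℝ s (x - w))
    refine (h1.sub h2).congr_deriv ?_
    simp
  have hlim := (hasDerivAt_iff_tendsto_slope.1 hder).mono_left
    (nhdsWithin_mono 0 (fun t (ht : t ∈ Ioi (0 : ℝ)) => (ne_of_gt ht : t ≠ 0)))
  have hge : (g w).toReal - (g x).toReal ≤
      inner ℝ (gradient (oracleDgf h γ) w) (x - w) - inner ℝ s (x - w) := by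
    refine ge_of_tendsto hlim ?_
    filter_upwards [Ioo_mem_nhdsGT (zero_lt_one' ℝ)] with t ht
    obtain ⟨h1, h2⟩ := convex_combination_le hg hc hwt hx (Ioo_subset_Icc_self ht)
    have h3 := oracle_le hg hw h1
    have h4 : inner ℝ s (AffineMap.lineMap w x t : E n) = inner ℝ s w + inner ℝ s (x - w) * t := by
      rw [AffineMap.lineMap_apply, vsub_eq_sub, vadd_eq_add, inner_add_right, inner_smul_right]
      ring
    rw [slope_def_field, le_div_iff₀ (by simpa using ht.1)]
    simp only [AffineMap.lineMap_apply_zero]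
    rw [h4] at h3
    linarith
  rw [inner_sub_left]
  linarith

/-- A convex subgradient of `g` added to the gradient of the smooth part is a regular subgradient
of the cost. -/
lemma mem_regSubdiff_cost (hg : IsProper g) (hf : ∀ i, ContDiff ℝ 2 (f i)) {w ξ : E n}
    (hw : g w ≠ ⊤)
    (hξ : ∀ x, g x ≠ ⊤ → (g w).toReal + inner ℝ ξ (x - w) ≤ (g x).toReal) :
    gradient (smoothPart f) w + ξ ∈ regSubdiff (cost f g) w := by
  have hcw := cost_eq_coe (f := f) hg hw
  refine ⟨by rw [hcw]; exact EReal.coe_ne_top _, by rw [hcw]; exact EReal.coe_ne_bot _, ?_⟩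
  let q : E n → ℝ := fun y => ‖y - w‖⁻¹ *
    (smoothPart f y - smoothPart f w - inner ℝ (gradient (smoothPart f) w) (y - w))
  have hq : Tendsto q (𝓝[≠] w) (𝓝 0) := by
    have h1 : HasGradientAt (smoothPart f) (gradient (smoothPart f) w) w :=
      (((contDiff_smoothPart hf).differentiable (by norm_num)) w).hasGradientAt
    have h2 := (hasFDerivAt_iff_tendsto.1 (hasGradientAt_iff_hasFDerivAt.1 h1)).mono_left
      (nhdsWithin_le_nhds (s := {w}ᶜ))
    rw [tendsto_zero_iff_norm_tendsto_zero]
    refine h2.congr fun y => ?_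
    simp [q, norm_mul]
  have hle : ∀ᶠ y in 𝓝[≠] w, ((q y : ℝ) : EReal) ≤
      (cost f g y - cost f g w
        - ((inner ℝ (gradient (smoothPart f) w + ξ) (y - w) : ℝ) : EReal)) /
        ((‖y - w‖ : ℝ) : EReal) := by
    filter_upwards [self_mem_nhdsWithin] with y hy
    have hpos : 0 < ‖y - w‖ := norm_pos_iff.2 (sub_ne_zero.2 hy)
    by_cases hyt : g y = ⊤
    · have h1 : cost f g y = ⊤ := by rw [cost, hyt, EReal.coe_add_top]
      rw [h1, hcw, EReal.top_sub_coe, EReal.top_sub_coe,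
        EReal.top_div_of_pos_ne_top (by exact_mod_cast hpos) (EReal.coe_ne_top _)]
      exact le_top
    · rw [cost_eq_coe hg hyt, hcw, ← EReal.coe_sub, ← EReal.coe_sub, ← EReal.coe_div,
        EReal.coe_le_coe_iff, le_div_iff₀ hpos, mul_comm, ← mul_assoc, mul_inv_cancel₀ hpos.ne',
        one_mul, inner_add_left]
      linarith [hξ y hyt]
  rcases (𝓝[≠] w).eq_or_neBot with hbot | hne
  · rw [hbot, liminf_bot]
    exact le_top
  · have h1 : Tendsto (fun y => ((q y : ℝ) : EReal)) (𝓝[≠] w) (𝓝 0) :=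
      (continuous_coe_real_ereal.tendsto 0).comp hq
    rw [← h1.liminf_eq]
    exact liminf_le_liminf hle

lemma regSubdiff_subset_subdiff (φ : E n → EReal) (x : E n) : regSubdiff φ x ⊆ subdiff φ x :=
  fun v hv => ⟨hv.1, hv.2.1, fun _ => x, fun _ => v, fun _ => hv, tendsto_const_nhds,
    tendsto_const_nhds, tendsto_const_nhds⟩

lemma sub_gradient_mem_regSubdiff (hg : IsProper g) (hc : IsConvexFun g)
    (hf : ∀ i, ContDiff ℝ 2 (f i)) (hh : ∀ i, ContDiff ℝ 2 (h i)) {s w : E n}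
    (hw : w ∈ oracle h g γ s) :
    s - gradient (hHat f h γ) w ∈ regSubdiff (cost f g) w := by
  have h1 := mem_regSubdiff_cost (f := f) hg hf (ne_top_of_mem_oracle hg hw)
    fun x hx => oracle_subgradient hg hc hh hw hx
  have h2 : gradient (smoothPart f) w + (s - gradient (oracleDgf h γ) w) =
      s - gradient (hHat f h γ) w := by
    rw [gradient_oracleDgf hf hh]
    abel
  rwa [h2] at h1

/-- Since `φ + ĥ = g + ∑ h_i / γ_i`, the oracle minimizes `φ + ĥ - ⟨s, ·⟩`. -/
lemma oracle_cost_le (hg : IsProper g) {s w x : E n} (hw : w ∈ oracle h g γ s) (hx : g x ≠ ⊤) :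
    (cost f g w).toReal + hHat f h γ w - inner ℝ s w ≤
      (cost f g x).toReal + hHat f h γ x - inner ℝ s x := by
  have h1 := oracle_le hg hw hx
  rw [← smoothPart_add_hHat f, ← smoothPart_add_hHat f] at h1
  rw [toReal_cost hg hx, toReal_cost hg (ne_top_of_mem_oracle hg hw)]
  linarith

/-- The Bregman proximal step decreases the Lyapunov function below the cost, with a surplus coming
from the strong convexity of the oracle's objective. -/
lemma lyapunov_add_bregman_le (hg : IsProper g) (hc : IsConvexFun g)
    (hh : ∀ i, ContDiff ℝ 2 (h i)) {z v : E n} (hz : g z ≠ ⊤)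
    (hv : v ∈ oracle h g γ (gradient (hHat f h γ) z)) :
    (cost f g v).toReal + bregman (hHat f h γ) v z + bregman (oracleDgf h γ) z v ≤
      (cost f g z).toReal := by
  have h1 := oracle_subgradient hg hc hh hv hz
  rw [toReal_cost hg hz, toReal_cost hg (ne_top_of_mem_oracle hg hv)]
  have h2 := smoothPart_add_hHat f h γ z
  have h3 := smoothPart_add_hHat f h γ v
  rw [inner_sub_left] at h1
  rw [bregman, bregman, ← neg_sub z v, inner_neg_right]
  linarith

end Oracle

/-! ### One outer iteration -/

section IncrementalLoop

variable {n N : ℕ} {f h : Fin N → E n → ℝ} {g : E n → EReal} {γ : Fin N → ℝ}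

/-- The contribution at `w` of the `i`-th index in visiting order, after `j` incremental steps:
`D(w, p_i) + D(p_i, u)` if it has been visited, `D(w, u)` if not, where `D` is the Bregman distance of
`ĥ_{σ i}`. The summand `D(p_i, u)` records the decrease already achieved. -/
noncomputable def loopTerm (f h : Fin N → E n → ℝ) (γ : Fin N → ℝ) (σ : Equiv.Perm (Fin N))
    (u : E n) (p : Fin N → E n) (j : Fin (N + 1)) (i : Fin N) (w : E n) : ℝ :=
  if i.castSucc < j then
    bregman (hHatI f h γ (σ i)) w (p i) + bregman (hHatI f h γ (σ i)) (p i) u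
  else bregman (hHatI f h γ (σ i)) w u

/-- The base point of the `i`-th visited component after `j` incremental steps. -/
def loopPoint (u : E n) (p : Fin N → E n) (j : Fin (N + 1)) (i : Fin N) : E n :=
  if i.castSucc < j then p i else u

lemma loop_vector_eq (hf : ∀ i, ContDiff ℝ 2 (f i)) (hh : ∀ i, ContDiff ℝ 2 (h i))
    (σ : Equiv.Perm (Fin N)) (u : E n) (p : Fin N → E n) (s : Fin (N + 1) → E n)
    (hs0 : s 0 = gradient (hHat f h γ) u)
    (hsucc : ∀ i : Fin N, s i.succ = s i.castSucc +
      (gradient (hHatI f h γ (σ i)) (p i) - gradient (hHatI f h γ (σ i)) u))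
    (j : Fin (N + 1)) :
    s j = ∑ i, gradient (hHatI f h γ (σ i)) (loopPoint u p j i) := by
  induction j using Fin.induction with
  | zero =>
    rw [hs0, gradient_hHat hf hh]
    simp only [loopPoint, Fin.not_lt_zero, if_false]
    exact (Equiv.sum_comp σ fun i => gradient (hHatI f h γ i) u).symm
  | succ j ih =>
    rw [hsucc, ih, eq_comm, ← sub_eq_iff_eq_add', ← Finset.sum_sub_distrib]
    rw [Finset.sum_eq_single j]
    · simp [loopPoint]
    · intro i _ hij
      have : i.castSucc < j.succ ↔ i.castSucc < j.castSucc := by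
        rw [Fin.castSucc_lt_succ_iff, Fin.castSucc_lt_castSucc_iff]
        exact ⟨fun hle => lt_of_le_of_ne hle hij, le_of_lt⟩
      simp [loopPoint, this]
    · simp

/-- The oracle at `s_j` minimizes `φ + ∑ loopTerm`, a function whose value at the current minimizer
is unchanged when the next base point is moved there. Hence every iterate of the incremental
loop stays below the value accepted by the linesearch. -/
lemma loop_descent (hg : IsProper g)
    (hf : ∀ i, ContDiff ℝ 2 (f i)) (hh : ∀ i, ContDiff ℝ 2 (h i))
    (σ : Equiv.Perm (Fin N)) (u y : E n) (p : Fin N → E n) (s : Fin (N + 1) → E n)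
    (hy : g y ≠ ⊤)
    (hs0 : s 0 = gradient (hHat f h γ) u)
    (hp : ∀ i, p i ∈ oracle h g γ (s i.castSucc))
    (hsucc : ∀ i : Fin N, s i.succ = s i.castSucc +
      (gradient (hHatI f h γ (σ i)) (p i) - gradient (hHatI f h γ (σ i)) u))
    (j : Fin (N + 1)) : ∀ x ∈ oracle h g γ (s j),
      (cost f g x).toReal + ∑ i, loopTerm f h γ σ u p j i x ≤
        (cost f g y).toReal + bregman (hHat f h γ) y u := by
  have key : ∀ j : Fin (N + 1), ∀ x ∈ oracle h g γ (s j), ∀ w, g w ≠ ⊤ →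
      (cost f g x).toReal + ∑ i, loopTerm f h γ σ u p j i x ≤
        (cost f g w).toReal + ∑ i, loopTerm f h γ σ u p j i w := by
    intro j x hx w hw
    have h1 := oracle_cost_le (f := f) hg hx hw
    have h2 : ∀ a b : E n, ∑ i, loopTerm f h γ σ u p j i a - ∑ i, loopTerm f h γ σ u p j i b =
        hHat f h γ a - hHat f h γ b - (inner ℝ (s j) a - inner ℝ (s j) b) := by
      intro a b
      have h3 : ∀ i, loopTerm f h γ σ u p j i a - loopTerm f h γ σ u p j i b =
          hHatI f h γ (σ i) a - hHatI f h γ (σ i) b -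
            (inner ℝ (gradient (hHatI f h γ (σ i)) (loopPoint u p j i)) a -
              inner ℝ (gradient (hHatI f h γ (σ i)) (loopPoint u p j i)) b) := by
        intro i
        by_cases hij : i.castSucc < j
        · simp only [loopTerm, loopPoint, hij, if_true, bregman, inner_sub_right]
          ring
        · simp only [loopTerm, loopPoint, hij, if_false, bregman, inner_sub_right]
          ring
      rw [← Finset.sum_sub_distrib, Finset.sum_congr rfl fun i _ => h3 i,
        loop_vector_eq hf hh σ u p s hs0 hsucc j]
      simp only [Finset.sum_sub_distrib, sum_inner, hHat]
      rw [Equiv.sum_comp σ fun i => hHatI f h γ i a, Equiv.sum_comp σ fun i => hHatI f h γ i b]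
    linarith [h2 x w]
  induction j using Fin.induction with
  | zero =>
    intro x hx
    refine (key 0 x hx y hy).trans (le_of_eq ?_)
    simp only [loopTerm, Fin.not_lt_zero, if_false]
    rw [bregman_hHat hf hh, Equiv.sum_comp σ fun i => bregman (hHatI f h γ i) y u]
  | succ j ih =>
    intro x hx
    refine (key j.succ x hx (p j) (ne_top_of_mem_oracle hg (hp j))).trans
      (le_trans (le_of_eq ?_) (ih (p j) (hp j)))
    congr 1
    refine Finset.sum_congr rfl fun i _ => ?_
    rcases eq_or_ne i j with rfl | hij
    · simp [loopTerm, bregman_self]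
    · have : i.castSucc < j.succ ↔ i.castSucc < j.castSucc := by
        rw [Fin.castSucc_lt_succ_iff, Fin.castSucc_lt_castSucc_iff]
        exact ⟨fun hle => lt_of_le_of_ne hle hij, le_of_lt⟩
      simp [loopTerm, this]

end IncrementalLoop

/-! ### Descent sequences with the Kurdyka–Łojasiewicz inequality -/

section DescentSequence

/-- The tangent line inequality for the concave function `s ↦ s ^ (1 - θ)`, multiplied by
`s ^ θ`. -/
lemma rpow_tangent_le {θ : ℝ} (hθ0 : 0 < θ) (hθ1 : θ < 1) {s t : ℝ} (hs : 0 < s) (ht : 0 ≤ t) :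
    (1 - θ) * (s - t) ≤ s ^ θ * (s ^ (1 - θ) - t ^ (1 - θ)) := by
  have h1 := Real.geom_mean_le_arith_mean2_weighted (by linarith : 0 ≤ 1 - θ) hθ0.le ht hs.le
    (by ring)
  have h2 : s ^ θ * s ^ (1 - θ) = s := by
    rw [← Real.rpow_add hs]
    simp
  rw [mul_sub (s ^ θ), h2, mul_comm (s ^ θ)]
  linarith

variable {X : Type*} [PseudoMetricSpace X] {z : ℕ → X} {e Δ : ℕ → ℝ} {x : X}
  {a b c ε η θ : ℝ}

lemma increment_le_sqrt (ha : 0 < a) (he0 : ∀ k, 0 ≤ e k)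
    (hdesc : ∀ k, e (k + 1) + a * Δ k ^ 2 ≤ e k) (k : ℕ) : Δ k ≤ √(e k) / √a := by
  rw [← Real.sqrt_div (he0 k)]
  refine Real.le_sqrt_of_sq_le ?_
  rw [le_div_iff₀ ha]
  linarith [hdesc k, he0 (k + 1)]

/-- Consecutive increments obey `2Δ_{k+1} ≤ Δ_k + C (ψ(e_{k+1}) - ψ(e_{k+2}))` wherever the
Kurdyka–Łojasiewicz inequality `e ^ θ ≤ cΔ` is available. -/
lemma two_mul_increment_le (ha : 0 < a) (hc : 0 ≤ c) (hθ0 : 0 < θ) (hθ1 : θ < 1)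
    (he0 : ∀ k, 0 ≤ e k) (hΔ0 : ∀ k, 0 ≤ Δ k) (hdesc : ∀ k, e (k + 1) + a * Δ k ^ 2 ≤ e k) {k : ℕ}
    (hKL : 0 < e (k + 1) → e (k + 1) ^ θ ≤ c * Δ k) :
    2 * Δ (k + 1) ≤ Δ k +
      c / ((1 - θ) * a) * (e (k + 1) ^ (1 - θ) - e (k + 2) ^ (1 - θ)) := by
  have hθ : 0 < 1 - θ := by linarith
  have hd := hdesc (k + 1)
  have hsq : 0 ≤ a * Δ (k + 1) ^ 2 := by positivity
  have hmono : e (k + 2) ≤ e (k + 1) := by linarith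
  have hdiff : 0 ≤ e (k + 1) ^ (1 - θ) - e (k + 2) ^ (1 - θ) :=
    sub_nonneg.2 (Real.rpow_le_rpow (he0 _) hmono hθ.le)
  set d := e (k + 1) ^ (1 - θ) - e (k + 2) ^ (1 - θ) with hd_def
  have hCd : 0 ≤ c / ((1 - θ) * a) * d := by positivity
  have hmain : Δ (k + 1) ^ 2 ≤ Δ k * (c / ((1 - θ) * a) * d) := by
    rcases (he0 (k + 1)).eq_or_lt with h0 | hpos
    · have h1 : a * Δ (k + 1) ^ 2 ≤ 0 := by linarith [he0 (k + 2)]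
      have h2 : Δ (k + 1) ^ 2 ≤ 0 := by
        by_contra hcon
        push Not at hcon
        linarith [mul_pos ha hcon]
      exact h2.trans (mul_nonneg (hΔ0 k) hCd)
    · have h1 := rpow_tangent_le hθ0 hθ1 hpos (he0 (k + 2))
      have h2 : e (k + 1) ^ θ * d ≤ c * Δ k * d := mul_le_mul_of_nonneg_right (hKL hpos) hdiff
      have h3 : (1 - θ) * (a * Δ (k + 1) ^ 2) ≤ (1 - θ) * (e (k + 1) - e (k + 2)) :=
        mul_le_mul_of_nonneg_left (by linarith) hθ.le
      have h4 : Δ k * (c / ((1 - θ) * a) * d) = c * Δ k * d / ((1 - θ) * a) := by ring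
      rw [h4, le_div_iff₀ (by positivity)]
      linarith
  have h5 : (2 * Δ (k + 1)) ^ 2 ≤ (Δ k + c / ((1 - θ) * a) * d) ^ 2 := by
    have := sq_nonneg (Δ k - c / ((1 - θ) * a) * d)
    linarith
  exact le_of_abs_le (abs_le_of_sq_le_sq h5 (add_nonneg (hΔ0 k) hCd))

/-- Near the cluster point `x` the potential `dist(z_{k+1}, x) + b (Δ_k + C ψ(e_{k+1}))` is
nonincreasing, so that the sequence cannot leave a small ball once the potential is small. -/
theorem tendsto_of_kl (ha : 0 < a) (hb : 0 ≤ b) (hc : 0 ≤ c) (hε : 0 < ε) (hη : 0 < η)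
    (hθ0 : 0 < θ) (hθ1 : θ < 1) (he0 : ∀ k, 0 ≤ e k) (hΔ0 : ∀ k, 0 ≤ Δ k)
    (hdesc : ∀ k, e (k + 1) + a * Δ k ^ 2 ≤ e k)
    (hstep : ∀ k, dist (z (k + 1)) (z k) ≤ b * Δ k) (hlim : Tendsto e atTop (𝓝 0))
    (hcluster : ∀ δ : ℝ, 0 < δ → ∀ K, ∃ k, K ≤ k ∧ dist (z k) x < δ)
    (hKL : ∀ k, dist (z (k + 1)) x ≤ ε → 0 < e (k + 1) → e (k + 1) < η →
      e (k + 1) ^ θ ≤ c * Δ k) :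
    Tendsto z atTop (𝓝 x) := by
  have hθ : 0 < 1 - θ := by linarith
  set C := c / ((1 - θ) * a)
  have hC : 0 ≤ C := by positivity
  let W : ℕ → ℝ := fun k => dist (z (k + 1)) x + b * (Δ k + C * e (k + 1) ^ (1 - θ))
  have hrest0 : ∀ k, 0 ≤ b * (Δ k + C * e (k + 1) ^ (1 - θ)) := fun k =>
    mul_nonneg hb (add_nonneg (hΔ0 k) (mul_nonneg hC (Real.rpow_nonneg (he0 _) _)))
  have hWstep : ∀ k, dist (z (k + 1)) x ≤ ε → e (k + 1) < η → W (k + 1) ≤ W k := by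
    intro k hk1 hk2
    have h1 := two_mul_increment_le ha hc hθ0 hθ1 he0 hΔ0 hdesc (hKL k hk1 · hk2)
    have h2 := mul_le_mul_of_nonneg_left h1 hb
    have h3 := dist_triangle (z (k + 2)) (z (k + 1)) x
    have h4 := hstep (k + 1)
    simp only [W]
    linarith
  have hΔlim : Tendsto Δ atTop (𝓝 0) := by
    refine squeeze_zero hΔ0 (increment_le_sqrt ha he0 hdesc) ?_
    simpa using (hlim.sqrt).div_const (√a)
  have hrest : Tendsto (fun k => b * (Δ k + C * e (k + 1) ^ (1 - θ))) atTop (𝓝 0) := by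
    have h1 : Tendsto (fun k => e (k + 1) ^ (1 - θ)) atTop (𝓝 0) := by
      have := ((tendsto_add_atTop_iff_nat 1).2 hlim).rpow_const (p := 1 - θ) (Or.inr hθ.le)
      rwa [Real.zero_rpow hθ.ne'] at this
    simpa using (hΔlim.add (h1.const_mul C)).const_mul b
  rw [Metric.tendsto_atTop]
  intro δ hδ
  obtain ⟨K, hK⟩ := eventually_atTop.1 ((hrest.eventually (gt_mem_nhds
    (show 0 < min δ ε / 2 by positivity))).and (hlim.eventually (gt_mem_nhds hη)))
  obtain ⟨k', hk', hdist⟩ := hcluster (min δ ε / 2) (by positivity) (K + 1)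
  obtain ⟨k, rfl⟩ : ∃ k, k' = k + 1 := ⟨k' - 1, by omega⟩
  have hWk : ∀ j, W (k + j) < min δ ε := by
    intro j
    induction j with
    | zero =>
      have := (hK k (by omega)).1
      simp only [W, add_zero]
      linarith
    | succ j ih =>
      refine lt_of_le_of_lt (hWstep (k + j) ?_ (hK (k + j + 1) (by omega)).2) ih
      have h1 := hrest0 (k + j)
      have h2 := min_le_right δ ε
      simp only [W] at ih
      linarith
  refine ⟨k + 1, fun m hm => ?_⟩
  obtain ⟨j, rfl⟩ := Nat.exists_eq_add_of_le hm
  have h1 := hWk j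
  have h2 := hrest0 (k + j)
  have h3 := min_le_left δ ε
  simp only [W] at h1
  rw [show k + 1 + j = k + j + 1 by omega]
  linarith

/-- For `θ ≤ 1/2` the Kurdyka–Łojasiewicz inequality gives `e_{k+1} ≤ C (e_k - e_{k+1})`. -/
theorem eventually_contraction_of_kl (ha : 0 < a) (hθ2 : θ ≤ 1 / 2) (hε : 0 < ε) (hη : 0 < η)
    (he0 : ∀ k, 0 ≤ e k) (hdesc : ∀ k, e (k + 1) + a * Δ k ^ 2 ≤ e k)
    (hlim : Tendsto e atTop (𝓝 0)) (hz : Tendsto z atTop (𝓝 x))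
    (hKL : ∀ k, dist (z (k + 1)) x ≤ ε → 0 < e (k + 1) → e (k + 1) < η →
      e (k + 1) ^ θ ≤ c * Δ k) :
    ∃ σ : ℝ, 0 < σ ∧ σ < 1 ∧ ∀ᶠ k in atTop, e (k + 1) ≤ σ * e k := by
  have hC : 0 < c ^ 2 / a + 1 := by positivity
  set C := c ^ 2 / a + 1
  refine ⟨C / (1 + C), by positivity, (div_lt_one (by positivity)).2 (by linarith), ?_⟩
  have h1 := (tendsto_add_atTop_iff_nat 1).2 hz
  have h2 := (tendsto_add_atTop_iff_nat 1).2 hlim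
  filter_upwards [h1.eventually (Metric.closedBall_mem_nhds x hε),
    h2.eventually (gt_mem_nhds hη), h2.eventually (gt_mem_nhds zero_lt_one)] with k hk1 hk2 hk3
  rw [div_mul_eq_mul_div, le_div_iff₀ (by positivity)]
  have hd := hdesc k
  suffices hsuff : e (k + 1) ≤ C * (e k - e (k + 1)) by linarith
  have hsub : 0 ≤ e k - e (k + 1) := by
    have : 0 ≤ a * Δ k ^ 2 := by positivity
    linarith
  rcases (he0 (k + 1)).eq_or_lt with h0 | hpos
  · rw [← h0] at hsub ⊢
    exact mul_nonneg hC.le hsub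
  · have h3 := hKL k hk1 hpos hk2
    calc e (k + 1) = e (k + 1) ^ (1 : ℝ) := (Real.rpow_one _).symm
      _ ≤ e (k + 1) ^ (θ * 2) :=
        Real.rpow_le_rpow_of_exponent_ge hpos hk3.le (by linarith)
      _ = (e (k + 1) ^ θ) ^ 2 := by rw [Real.rpow_mul hpos.le]; norm_cast
      _ ≤ (c * Δ k) ^ 2 := by gcongr
      _ = c ^ 2 / a * (a * Δ k ^ 2) := by field_simp
      _ ≤ c ^ 2 / a * (e k - e (k + 1)) := by gcongr; linarith
      _ ≤ C * (e k - e (k + 1)) := by gcongr; simp [C]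

/-- The increments are bounded by `√e`, which contracts geometrically, so the tail of the path from
`z_k` to its limit is bounded by a multiple of `√(e_k)`. -/
theorem eventually_dist_le_sqrt (ha : 0 < a) (hb : 0 ≤ b) {σ : ℝ} (hσ0 : 0 < σ) (hσ1 : σ < 1)
    (he0 : ∀ k, 0 ≤ e k) (hdesc : ∀ k, e (k + 1) + a * Δ k ^ 2 ≤ e k)
    (hstep : ∀ k, dist (z (k + 1)) (z k) ≤ b * Δ k) (hlim : Tendsto e atTop (𝓝 0))
    (hz : Tendsto z atTop (𝓝 x)) (hcontr : ∀ᶠ k in atTop, e (k + 1) ≤ σ * e k) :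
    ∃ M : ℝ, 0 ≤ M ∧ ∀ᶠ k in atTop, dist (z k) x ≤ M * √(e k) := by
  have hq1 : √σ < 1 := by rw [Real.sqrt_lt' one_pos]; simpa using hσ1
  have hq : 0 < 1 - √σ := by linarith
  set M := b / √a / (1 - √σ) with hM
  have hM0 : 0 ≤ M := by positivity
  refine ⟨M, hM0, ?_⟩
  obtain ⟨K, hK⟩ := eventually_atTop.1 hcontr
  have hstep' : ∀ k, K ≤ k →
      dist (z k) x - M * √(e k) ≤ dist (z (k + 1)) x - M * √(e (k + 1)) := by
    intro k hk
    have h1 : √(e (k + 1)) ≤ √σ * √(e k) := by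
      rw [← Real.sqrt_mul hσ0.le]
      exact Real.sqrt_le_sqrt (hK k hk)
    have h2 := dist_triangle (z k) (z (k + 1)) x
    rw [dist_comm (z k) (z (k + 1))] at h2
    have h3 : b * Δ k ≤ b / √a * √(e k) := by
      have := mul_le_mul_of_nonneg_left (increment_le_sqrt ha he0 hdesc k) hb
      calc b * Δ k ≤ b * (√(e k) / √a) := this
        _ = _ := by ring
    have h4 : M * (1 - √σ) = b / √a := div_mul_cancel₀ _ hq.ne'
    have h5 := mul_le_mul_of_nonneg_left h1 hM0
    have h6 : b / √a * √(e k) = M * √(e k) - M * (√σ * √(e k)) := by rw [← h4]; ring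
    linarith [hstep k]
  have hmono : ∀ k, K ≤ k → ∀ j, dist (z k) x - M * √(e k) ≤
      dist (z (k + j)) x - M * √(e (k + j)) := by
    intro k hk j
    induction j with
    | zero => simp
    | succ j ih => exact ih.trans (hstep' (k + j) (by omega))
  have hX : Tendsto (fun k => dist (z k) x - M * √(e k)) atTop (𝓝 0) := by
    simpa using (tendsto_iff_dist_tendsto_zero.1 hz).sub ((hlim.sqrt).const_mul M)
  filter_upwards [eventually_ge_atTop K] with k hk
  have h1 : Tendsto (fun j => dist (z (k + j)) x - M * √(e (k + j))) atTop (𝓝 0) := by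
    simpa [add_comm] using (tendsto_add_atTop_iff_nat k).2 hX
  linarith [ge_of_tendsto' h1 (hmono k hk)]

lemma rLinear_of_eventually {w : ℕ → ℝ} {q : ℝ} (hq0 : 0 < q) (hq1 : q < 1) (hw0 : ∀ k, 0 ≤ w k)
    (hw : ∀ᶠ k in atTop, w (k + 1) ≤ q * w k) (hz : ∀ᶠ k in atTop, dist (z k) x ≤ w k) :
    RLinear z x := by
  obtain ⟨K, hK⟩ := eventually_atTop.1 (hw.and hz)
  refine ⟨fun k => if K ≤ k then w k else dist (z k) x, fun k => ?_, fun k => ?_, q, hq0, hq1, K,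
    fun k hk => ?_⟩
  · dsimp only
    split_ifs
    exacts [hw0 k, dist_nonneg]
  · dsimp only
    split_ifs with h
    exacts [(hK k h).2, le_rfl]
  · simp only [hk, (show K ≤ k + 1 by omega), if_true, Real.dist_0_eq_abs, abs_of_nonneg (hw0 _)]
    exact (hK k hk).1

end DescentSequence

/-! ### Descent estimates for a run of SPIRAL -/

section RunEstimates

variable {n N : ℕ} {f h : Fin N → E n → ℝ} {g : E n → EReal} {γ L : Fin N → ℝ}

/-- The regularity assumptions on the data of the finite sum problem and on the stepsizes. -/
structure IsAdmissible (f h : Fin N → E n → ℝ) (g : E n → EReal) (L γ : Fin N → ℝ) : Prop where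
  card_pos : 0 < N
  dgf : ∀ i, IsDgf (h i)
  smooth : ∀ i, IsRelSmooth (L i) (h i) (f i)
  proper : IsProper g
  lsc : LowerSemicontinuous g
  convex : IsConvexFun g
  f_C2 : ∀ i, ContDiff ℝ 2 (f i)
  h_C2 : ∀ i, ContDiff ℝ 2 (h i)
  hess : ∀ i, HessianPosDef (h i)
  stepsize_pos : ∀ i, 0 < γ i
  stepsize_lt : ∀ i, γ i * L i < (N : ℝ)

variable {β : ℝ} {zInit : E n} (R : Run f h g γ β zInit)

/-- The base point `u^k` of the accepted linesearch trial. -/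
def Run.base (k : ℕ) : E n := R.u k (R.m k)

/-- The real value `φ(z^k)`. -/
noncomputable def Run.value (k : ℕ) : ℝ := (cost f g (R.z k)).toReal

/-- The Euclidean size of the `k`-th outer iteration: the root of the sum of the squared distances
whose Bregman counterparts appear in the decrease of the cost. -/
noncomputable def Run.increment (k : ℕ) : ℝ :=
  √(‖R.z k - R.v k‖ ^ 2 +
    ∑ i, (‖R.z (k + 1) - R.zTilde k i‖ ^ 2 + ‖R.zTilde k i - R.base k‖ ^ 2))

lemma Run.increment_sq (k : ℕ) : R.increment k ^ 2 = ‖R.z k - R.v k‖ ^ 2 +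
    ∑ i, (‖R.z (k + 1) - R.zTilde k i‖ ^ 2 + ‖R.zTilde k i - R.base k‖ ^ 2) :=
  Real.sq_sqrt (by positivity)

lemma Run.norm_sub_v_le (k : ℕ) : ‖R.z k - R.v k‖ ≤ R.increment k :=
  Real.le_sqrt_of_sq_le (le_add_of_nonneg_right (by positivity))

lemma Run.norm_sq_add_le (k : ℕ) (i : Fin N) :
    ‖R.z (k + 1) - R.zTilde k i‖ ^ 2 + ‖R.zTilde k i - R.base k‖ ^ 2 ≤ R.increment k ^ 2 := by
  rw [R.increment_sq]
  have := Finset.single_le_sum (f := fun i => ‖R.z (k + 1) - R.zTilde k i‖ ^ 2 +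
    ‖R.zTilde k i - R.base k‖ ^ 2) (fun i _ => by positivity) (Finset.mem_univ i)
  have h0 : 0 ≤ ‖R.z k - R.v k‖ ^ 2 := by positivity
  linarith

lemma Run.norm_sub_zTilde_le (k : ℕ) (i : Fin N) :
    ‖R.z (k + 1) - R.zTilde k i‖ ≤ R.increment k := by
  refine le_of_abs_le (abs_le_of_sq_le_sq ?_ (Real.sqrt_nonneg _))
  linarith [R.norm_sq_add_le k i, sq_nonneg ‖R.zTilde k i - R.base k‖]

lemma Run.norm_zTilde_sub_le (k : ℕ) (i : Fin N) :
    ‖R.zTilde k i - R.base k‖ ≤ R.increment k := by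
  refine le_of_abs_le (abs_le_of_sq_le_sq ?_ (Real.sqrt_nonneg _))
  linarith [R.norm_sq_add_le k i, sq_nonneg ‖R.z (k + 1) - R.zTilde k i‖]

lemma lyapunov_eq_coe (hg : IsProper g) {y u : E n} (hy : g y ≠ ⊤) :
    lyapunov f h g γ y u =
      (((cost f g y).toReal + bregman (hHat f h γ) y u : ℝ) : EReal) := by
  rw [lyapunov, EReal.coe_add, toReal_cost hg hy, ← cost_eq_coe hg hy]

/-- The linesearch test and the proximal step: `ℒ(y^k, u^k) ≤ ℒ(v^k, z^k)`, which lies below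
`φ(z^k)`. -/
lemma Run.lyapunov_accepted_le (S : IsAdmissible f h g L γ) (k : ℕ) :
    (cost f g (R.y k (R.m k))).toReal + bregman (hHat f h γ) (R.y k (R.m k)) (R.base k) +
      bregman (oracleDgf h γ) (R.z k) (R.v k) ≤ R.value k := by
  have h1 := R.ls_accept k
  rw [lyapunov_eq_coe S.proper (ne_top_of_mem_oracle S.proper (R.y_mem k _ le_rfl)),
    lyapunov_eq_coe S.proper (ne_top_of_mem_oracle S.proper (R.v_mem k)),
    EReal.coe_le_coe_iff] at h1
  have h2 := lyapunov_add_bregman_le (f := f) S.proper S.convex S.h_C2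
    (ne_top_of_mem_oracle S.proper (R.z_mem k)) (R.v_mem k)
  simp only [Run.value, Run.base]
  linarith

lemma IsAdmissible.bregman_oracleDgf_nonneg (S : IsAdmissible f h g L γ) (y x : E n) :
    0 ≤ bregman (oracleDgf h γ) y x := by
  rw [bregman_oracleDgf S.h_C2]
  exact Finset.sum_nonneg fun i _ => mul_nonneg (one_div_pos.2 (S.stepsize_pos i)).le
    (bregman_nonneg (S.dgf i).1.convexOn ((S.h_C2 i).differentiable (by norm_num)) _ _)

lemma IsAdmissible.bregman_hHatI_nonneg (S : IsAdmissible f h g L γ) (i : Fin N) (y x : E n) :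
    0 ≤ bregman (hHatI f h γ i) y x :=
  Spiral.bregman_hHatI_nonneg S.card_pos S.dgf S.smooth S.f_C2 S.h_C2 S.stepsize_pos
    S.stepsize_lt i y x

lemma Run.loop_descent (S : IsAdmissible f h g L γ) (k : ℕ) (j : Fin (N + 1)) {x : E n}
    (hx : x ∈ oracle h g γ (R.sInner k j)) :
    (cost f g x).toReal + ∑ i, loopTerm f h γ (R.perm k) (R.base k) (R.zTilde k) j i x +
      bregman (oracleDgf h γ) (R.z k) (R.v k) ≤ R.value k := by
  have h1 := Spiral.loop_descent S.proper S.f_C2 S.h_C2 (R.perm k) (R.base k)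
    (R.y k (R.m k)) (R.zTilde k) (R.sInner k)
    (ne_top_of_mem_oracle S.proper (R.y_mem k _ le_rfl))
    (by rw [R.sInner_zero, R.sTilde_eq k _ le_rfl, Run.base]) (R.zTilde_mem k) (R.sInner_succ k)
    j x hx
  linarith [R.lyapunov_accepted_le S k]

lemma Run.value_succ_add_le (S : IsAdmissible f h g L γ) (k : ℕ) :
    R.value (k + 1) + ∑ i, (bregman (hHatI f h γ (R.perm k i)) (R.z (k + 1)) (R.zTilde k i) +
      bregman (hHatI f h γ (R.perm k i)) (R.zTilde k i) (R.base k)) +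
      bregman (oracleDgf h γ) (R.z k) (R.v k) ≤ R.value k := by
  have h1 := R.loop_descent S k (Fin.last N) (x := R.z (k + 1))
    (by rw [← R.s_succ]; exact R.z_mem (k + 1))
  simp only [loopTerm, Fin.castSucc_lt_last, if_true] at h1
  exact h1

lemma Run.cost_zTilde_le (S : IsAdmissible f h g L γ) (k : ℕ) (j : Fin N) :
    (cost f g (R.zTilde k j)).toReal ≤ R.value k := by
  have h1 := R.loop_descent S k j.castSucc (R.zTilde_mem k j)
  have h2 : 0 ≤ ∑ i, loopTerm f h γ (R.perm k) (R.base k) (R.zTilde k) j.castSucc i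
      (R.zTilde k j) := by
    refine Finset.sum_nonneg fun i _ => ?_
    rw [loopTerm]
    split_ifs
    · exact add_nonneg (S.bregman_hHatI_nonneg _ _ _) (S.bregman_hHatI_nonneg _ _ _)
    · exact S.bregman_hHatI_nonneg _ _ _
  linarith [S.bregman_oracleDgf_nonneg (R.z k) (R.v k)]

lemma Run.cost_v_le (S : IsAdmissible f h g L γ) (k : ℕ) :
    (cost f g (R.v k)).toReal ≤ R.value k := by
  have h1 := lyapunov_add_bregman_le (f := f) S.proper S.convex S.h_C2
    (ne_top_of_mem_oracle S.proper (R.z_mem k)) (R.v_mem k)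
  have h2 : 0 ≤ bregman (hHat f h γ) (R.v k) (R.z k) := by
    rw [bregman_hHat S.f_C2 S.h_C2]
    exact Finset.sum_nonneg fun i _ => S.bregman_hHatI_nonneg i _ _
  have h3 := S.bregman_oracleDgf_nonneg (R.z k) (R.v k)
  rw [Run.value]
  linarith

lemma Run.value_antitone (S : IsAdmissible f h g L γ) : Antitone R.value := by
  refine antitone_nat_of_succ_le fun k => ?_
  have h1 := R.value_succ_add_le S k
  have h2 : 0 ≤ ∑ i, (bregman (hHatI f h γ (R.perm k i)) (R.z (k + 1)) (R.zTilde k i) +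
      bregman (hHatI f h γ (R.perm k i)) (R.zTilde k i) (R.base k)) :=
    Finset.sum_nonneg fun i _ =>
      add_nonneg (S.bregman_hHatI_nonneg _ _ _) (S.bregman_hHatI_nonneg _ _ _)
  linarith [S.bregman_oracleDgf_nonneg (R.z k) (R.v k)]

lemma Run.norm_base_sub_le (hβ0 : 0 < β) (hβ1 : β < 1) {D : ℝ}
    (hd : ∀ k, ‖R.d k‖ ≤ D * ‖R.z k - R.v k‖) (k : ℕ) :
    ‖R.base k - R.z k‖ ≤ (1 + D) * ‖R.z k - R.v k‖ := by
  have hτ0 : 0 ≤ β ^ R.m k := by positivity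
  have hτ1 : β ^ R.m k ≤ 1 := pow_le_one₀ hβ0.le hβ1.le
  have h1 : R.base k - R.z k =
      (1 - β ^ R.m k) • (R.v k - R.z k) + β ^ R.m k • R.d k := by
    rw [Run.base, R.u_eq k _ le_rfl]
    abel
  have hn : 0 ≤ ‖R.z k - R.v k‖ := norm_nonneg _
  calc ‖R.base k - R.z k‖
      ≤ ‖(1 - β ^ R.m k) • (R.v k - R.z k)‖ + ‖β ^ R.m k • R.d k‖ := by
        rw [h1]; exact norm_add_le _ _
    _ = (1 - β ^ R.m k) * ‖R.z k - R.v k‖ + β ^ R.m k * ‖R.d k‖ := by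
        rw [norm_smul, norm_smul, Real.norm_of_nonneg hτ0, Real.norm_of_nonneg (by linarith),
          norm_sub_rev (R.v k)]
    _ ≤ 1 * ‖R.z k - R.v k‖ + 1 * (D * ‖R.z k - R.v k‖) := by
        gcongr
        · linarith
        · exact hd k
    _ = (1 + D) * ‖R.z k - R.v k‖ := by ring

/-- All points generated by the run lie in one ball, because the oracle outputs belong to a sublevel
set of the cost. -/
lemma Run.exists_ball (S : IsAdmissible f h g L γ) (hlev : IsLevelBounded (cost f g))
    (hβ0 : 0 < β) (hβ1 : β < 1) {D : ℝ} (hD : 0 ≤ D)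
    (hd : ∀ k, ‖R.d k‖ ≤ D * ‖R.z k - R.v k‖) :
    ∃ r : ℝ, ∀ k, R.z k ∈ Metric.closedBall (0 : E n) r ∧
      R.v k ∈ Metric.closedBall (0 : E n) r ∧ R.base k ∈ Metric.closedBall (0 : E n) r ∧
      ∀ i, R.zTilde k i ∈ Metric.closedBall (0 : E n) r := by
  obtain ⟨r, hr⟩ := (hlev (R.value 0)).subset_closedBall 0
  have hmem : ∀ {w s : E n} (k : ℕ), w ∈ oracle h g γ s → (cost f g w).toReal ≤ R.value k →
      ‖w‖ ≤ r := by
    intro w s k hw hle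
    have h1 : cost f g w ≤ (R.value 0 : EReal) := by
      have hwt := ne_top_of_mem_oracle S.proper hw
      rw [cost_eq_coe S.proper hwt, EReal.coe_le_coe_iff, ← toReal_cost S.proper hwt]
      exact hle.trans (R.value_antitone S (Nat.zero_le k))
    simpa using hr h1
  have hz : ∀ k, ‖R.z k‖ ≤ r := fun k => hmem k (R.z_mem k) le_rfl
  have hv : ∀ k, ‖R.v k‖ ≤ r := fun k => hmem k (R.v_mem k) (R.cost_v_le S k)
  have hr0 : 0 ≤ r := (norm_nonneg _).trans (hz 0)
  have hge : r ≤ r + (1 + D) * (r + r) := le_add_of_nonneg_right (by positivity)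
  refine ⟨r + (1 + D) * (r + r), fun k => ?_⟩
  simp only [mem_closedBall_zero_iff]
  refine ⟨(hz k).trans hge, (hv k).trans hge, ?_,
    fun i => (hmem k (R.zTilde_mem k i) (R.cost_zTilde_le S k i)).trans hge⟩
  calc ‖R.base k‖ = ‖R.z k + (R.base k - R.z k)‖ := by rw [add_sub_cancel]
    _ ≤ ‖R.z k‖ + ‖R.base k - R.z k‖ := norm_add_le _ _
    _ ≤ r + (1 + D) * (r + r) := by
        refine add_le_add (hz k) ((R.norm_base_sub_le hβ0 hβ1 hd k).trans ?_)
        gcongr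
        exact (norm_sub_le _ _).trans (add_le_add (hz k) (hv k))

/-- The subgradient of the cost at `z^k` supplied by the oracle. -/
noncomputable def Run.subgrad (k : ℕ) : E n := R.s k - gradient (hHat f h γ) (R.z k)

lemma Run.subgrad_mem (S : IsAdmissible f h g L γ) (k : ℕ) :
    R.subgrad k ∈ regSubdiff (cost f g) (R.z k) :=
  sub_gradient_mem_regSubdiff S.proper S.convex S.f_C2 S.h_C2 (R.z_mem k)

lemma Run.subgrad_succ_eq (S : IsAdmissible f h g L γ) (k : ℕ) :
    R.subgrad (k + 1) = ∑ i, (gradient (hHatI f h γ (R.perm k i)) (R.zTilde k i) -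
      gradient (hHatI f h γ (R.perm k i)) (R.z (k + 1))) := by
  have h1 := loop_vector_eq S.f_C2 S.h_C2 (R.perm k) (R.base k) (R.zTilde k) (R.sInner k)
    (by rw [R.sInner_zero, R.sTilde_eq k _ le_rfl, Run.base]) (R.sInner_succ k) (Fin.last N)
  simp only [loopPoint, Fin.castSucc_lt_last, if_true] at h1
  rw [Run.subgrad, R.s_succ, h1, gradient_hHat S.f_C2 S.h_C2, Finset.sum_sub_distrib,
    Equiv.sum_comp (R.perm k) fun i => gradient (hHatI f h γ i) (R.z (k + 1))]

/-- The three estimates that drive the convergence: sufficient decrease of the cost, control of the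
steps, and control of the subgradients, all in terms of the increments. -/
theorem Run.exists_estimates (S : IsAdmissible f h g L γ) (hlev : IsLevelBounded (cost f g))
    (hβ0 : 0 < β) (hβ1 : β < 1) {D : ℝ} (hD : 0 ≤ D)
    (hd : ∀ k, ‖R.d k‖ ≤ D * ‖R.z k - R.v k‖) :
    ∃ a b c : ℝ, 0 < a ∧ 0 ≤ b ∧ 0 ≤ c ∧
      (∀ k, R.value (k + 1) + a * R.increment k ^ 2 ≤ R.value k) ∧
      (∀ k, dist (R.z (k + 1)) (R.z k) ≤ b * R.increment k) ∧
      (∀ k, ‖R.subgrad (k + 1)‖ ≤ c * R.increment k) := by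
  obtain ⟨r, hr⟩ := R.exists_ball S hlev hβ0 hβ1 hD hd
  obtain ⟨a, ha0, ha⟩ := exists_bregman_ge_uniform S.card_pos S.dgf S.smooth S.f_C2 S.h_C2 S.hess
    S.stepsize_pos S.stepsize_lt r
  obtain ⟨C, hC0, hC⟩ := exists_gradient_hHatI_lipschitz (γ := γ) S.f_C2 S.h_C2 r
  refine ⟨a, 1 + 1 + (1 + D), ∑ _i : Fin N, C, ha0, by positivity,
    Finset.sum_nonneg fun _ _ => hC0, fun k => ?_, fun k => ?_, fun k => ?_⟩
  · obtain ⟨hz, hv, hu, ht⟩ := hr k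
    have h1 := R.value_succ_add_le S k
    have h2 := (ha _ hv _ hz).1
    have h3 : a * ∑ i, (‖R.z (k + 1) - R.zTilde k i‖ ^ 2 + ‖R.zTilde k i - R.base k‖ ^ 2) ≤
        ∑ i, (bregman (hHatI f h γ (R.perm k i)) (R.z (k + 1)) (R.zTilde k i) +
          bregman (hHatI f h γ (R.perm k i)) (R.zTilde k i) (R.base k)) := by
      rw [Finset.mul_sum]
      refine Finset.sum_le_sum fun i _ => ?_
      rw [mul_add]
      exact add_le_add ((ha _ (ht i) _ (hr (k + 1)).1).2 _) ((ha _ hu _ (ht i)).2 _)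
    rw [R.increment_sq, mul_add]
    linarith
  · let i : Fin N := ⟨0, S.card_pos⟩
    have h1 : R.z (k + 1) - R.z k = (R.z (k + 1) - R.zTilde k i) +
        (R.zTilde k i - R.base k) + (R.base k - R.z k) := by abel
    have h2 := R.norm_base_sub_le hβ0 hβ1 hd k
    have h3 : (1 + D) * ‖R.z k - R.v k‖ ≤ (1 + D) * R.increment k := by
      gcongr
      exact R.norm_sub_v_le k
    rw [dist_eq_norm, h1]
    have h4 := norm_add₃_le (a := R.z (k + 1) - R.zTilde k i) (b := R.zTilde k i - R.base k)
      (c := R.base k - R.z k)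
    linarith [R.norm_sub_zTilde_le k i, R.norm_zTilde_sub_le k i]
  · rw [R.subgrad_succ_eq S, Finset.sum_mul]
    refine (norm_sum_le _ _).trans (Finset.sum_le_sum fun i _ => ?_)
    refine (hC _ _ ((hr k).2.2.2 i) _ (hr (k + 1)).1).trans ?_
    gcongr
    rw [norm_sub_rev]
    exact R.norm_sub_zTilde_le k i

end RunEstimates

/-! ### Cluster points are stationary -/

section ClusterPoints

variable {n N : ℕ} {f h : Fin N → E n → ℝ} {g : E n → EReal} {γ L : Fin N → ℝ}
  {β : ℝ} {zInit : E n} (R : Run f h g γ β zInit)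

/-- The subgradient inequality passes to the limit along a subsequence: the lower bound for `g` at
the cluster point comes from semicontinuity, the upper bound from the inequality tested at the
cluster point itself. -/
lemma Run.stationary_of_tendsto (S : IsAdmissible f h g L γ) {ψ : ℕ → ℕ} {zs : E n} {Φ : ℝ}
    (hz : Tendsto (fun j => R.z (ψ j)) atTop (𝓝 zs))
    (hΦ : Tendsto (fun j => R.value (ψ j)) atTop (𝓝 Φ))
    (hξ : Tendsto (fun j => R.subgrad (ψ j)) atTop (𝓝 0)) :
    g zs ≠ ⊤ ∧ (cost f g zs).toReal = Φ ∧ IsStationary (cost f g) zs := by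
  have hFc : Continuous (smoothPart f) := (contDiff_smoothPart S.f_C2).continuous
  have hGc : Continuous (gradient (smoothPart f)) :=
    (contDiff_gradient (contDiff_smoothPart S.f_C2)).continuous
  have hzt : ∀ k, g (R.z k) ≠ ⊤ := fun k => ne_top_of_mem_oracle S.proper (R.z_mem k)
  have hg : Tendsto (fun j => (g (R.z (ψ j))).toReal) atTop (𝓝 (Φ - smoothPart f zs)) := by
    refine (hΦ.sub ((hFc.tendsto zs).comp hz)).congr fun j => ?_
    rw [Run.value, toReal_cost S.proper (hzt _)]
    simp
  have hlsc : g zs ≤ ((Φ - smoothPart f zs : ℝ) : EReal) := by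
    by_contra hcon
    push Not at hcon
    obtain ⟨y, hy1, hy2⟩ := EReal.lt_iff_exists_real_btwn.1 hcon
    have h1 := hz.eventually (S.lsc zs _ hy2)
    have h2 := hg.eventually (gt_mem_nhds (EReal.coe_lt_coe_iff.1 hy1))
    obtain ⟨j, hj1, hj2⟩ := (h1.and h2).exists
    rw [← coe_toReal_of_isProper S.proper (hzt _)] at hj1
    exact lt_asymm (EReal.coe_lt_coe_iff.1 hj1) hj2
  have hzs : g zs ≠ ⊤ := ne_top_of_le_ne_top (EReal.coe_ne_top _) hlsc
  have hlim : ∀ x, g x ≠ ⊤ →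
      Φ - smoothPart f zs + inner ℝ (-gradient (smoothPart f) zs) (x - zs) ≤ (g x).toReal := by
    intro x hx
    have h1 : Tendsto (fun j => (g (R.z (ψ j))).toReal +
        inner ℝ (R.subgrad (ψ j) - gradient (smoothPart f) (R.z (ψ j))) (x - R.z (ψ j))) atTop
        (𝓝 (Φ - smoothPart f zs + inner ℝ (0 - gradient (smoothPart f) zs) (x - zs))) :=
      hg.add ((hξ.sub ((hGc.tendsto zs).comp hz)).inner (tendsto_const_nhds.sub hz))
    rw [zero_sub] at h1
    refine le_of_tendsto' h1 fun j => ?_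
    have h2 := oracle_subgradient S.proper S.convex S.h_C2 (R.z_mem (ψ j)) hx
    have h3 : R.s (ψ j) - gradient (oracleDgf h γ) (R.z (ψ j)) =
        R.subgrad (ψ j) - gradient (smoothPart f) (R.z (ψ j)) := by
      rw [Run.subgrad, gradient_oracleDgf S.f_C2 S.h_C2]
      abel
    rwa [h3] at h2
  have hval : (g zs).toReal = Φ - smoothPart f zs := by
    refine le_antisymm ?_ (by simpa using hlim zs hzs)
    rwa [← coe_toReal_of_isProper S.proper hzs, EReal.coe_le_coe_iff] at hlsc
  refine ⟨hzs, by rw [toReal_cost S.proper hzs, hval]; ring, ?_⟩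
  have h1 := mem_regSubdiff_cost (f := f) (ξ := -gradient (smoothPart f) zs) S.proper S.f_C2 hzs
    fun x hx => by rw [hval]; exact hlim x hx
  rwa [add_neg_cancel] at h1

lemma rpow_le_of_kl {ρ θ e : ℝ} (hρ : 0 < ρ) (hθ1 : θ < 1) (he : 0 < e) {A : Set (E n)} {ξ : E n}
    (hξ : ξ ∈ A)
    (hKL : 1 ≤ ENNReal.ofReal (deriv (desing ρ θ) e) * Metric.infEDist (0 : E n) A) :
    e ^ θ ≤ ρ * (1 - θ) * ‖ξ‖ := by
  have hθ : 0 < 1 - θ := by linarith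
  have hder : deriv (desing ρ θ) e = ρ * ((1 - θ) * e ^ (-θ)) := by
    have h1 := (Real.hasDerivAt_rpow_const (p := 1 - θ) (Or.inl he.ne')).const_mul ρ
    rw [show (1 - θ - 1 : ℝ) = -θ by ring] at h1
    exact h1.deriv
  have hd0 : 0 ≤ ρ * ((1 - θ) * e ^ (-θ)) := by positivity
  have h1 : Metric.infEDist (0 : E n) A ≤ ENNReal.ofReal ‖ξ‖ := by
    refine (Metric.infEDist_le_edist_of_mem hξ).trans (le_of_eq ?_)
    rw [edist_dist, dist_zero_left]
  have h2 : (1 : ENNReal) ≤ ENNReal.ofReal (ρ * ((1 - θ) * e ^ (-θ)) * ‖ξ‖) := by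
    rw [ENNReal.ofReal_mul hd0, ← hder]
    exact hKL.trans (by gcongr)
  rw [ENNReal.one_le_ofReal] at h2
  have h3 : e ^ θ * e ^ (-θ) = 1 := by rw [← Real.rpow_add he]; simp
  calc e ^ θ = e ^ θ * 1 := (mul_one _).symm
    _ ≤ e ^ θ * (ρ * ((1 - θ) * e ^ (-θ)) * ‖ξ‖) := by gcongr
    _ = (e ^ θ * e ^ (-θ)) * (ρ * (1 - θ) * ‖ξ‖) := by ring
    _ = _ := by rw [h3, one_mul]

end ClusterPoints

end Spiral

theorem mainTheorem2 (n N : ℕ) (hN : 0 < N)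
    (f h : Fin N → Spiral.E n → ℝ) (g : Spiral.E n → EReal) (L : Fin N → ℝ)
    (hdgf : ∀ i, Spiral.IsDgf (h i))
    (hsmooth : ∀ i, Spiral.IsRelSmooth (L i) (h i) (f i))
    (hg_proper : Spiral.IsProper g) (hg_lsc : LowerSemicontinuous g)
    (hsol : (Spiral.argmin (Spiral.cost f g)).Nonempty)
    (hg_convex : Spiral.IsConvexFun g)
    (hf_C2 : ∀ i, ContDiff ℝ 2 (f i)) (hh_C2 : ∀ i, ContDiff ℝ 2 (h i))
    (hh_hess : ∀ i, Spiral.HessianPosDef (h i))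
    (hlev : Spiral.IsLevelBounded (Spiral.cost f g))
    (θ : ℝ) (hθ0 : 0 < θ) (hθ1 : θ < 1) (hKL : Spiral.HasKL (Spiral.cost f g) θ)
    (γ : Fin N → ℝ) (hγ0 : ∀ i, 0 < γ i) (hγL : ∀ i, γ i * L i < (N : ℝ))
    (β : ℝ) (hβ0 : 0 < β) (hβ1 : β < 1) (zInit : Spiral.E n)
    (R : Spiral.Run f h g γ β zInit)
    (D : ℝ) (hD : 0 ≤ D) (hd : ∀ k, ‖R.d k‖ ≤ D * ‖R.z k - R.v k‖) :
    ∃ zs : Spiral.E n,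
      Filter.Tendsto R.z Filter.atTop (nhds zs) ∧
      Spiral.IsStationary (Spiral.cost f g) zs ∧
      (θ ≤ 1 / 2 →
        Spiral.RLinear R.z zs ∧
        (∀ k, Spiral.cost f g (R.z k) ≠ ⊤ ∧ Spiral.cost f g (R.z k) ≠ ⊥) ∧
        Spiral.RLinear (fun k => (Spiral.cost f g (R.z k)).toReal)
          (Spiral.cost f g zs).toReal) := by
  open Spiral in
  have S : IsAdmissible f h g L γ :=
    ⟨hN, hdgf, hsmooth, hg_proper, hg_lsc, hg_convex, hf_C2, hh_C2, hh_hess, hγ0, hγL⟩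
  have hzt : ∀ k, g (R.z k) ≠ ⊤ := fun k => ne_top_of_mem_oracle hg_proper (R.z_mem k)
  have hcoe : ∀ {w : E n}, g w ≠ ⊤ → ((cost f g w).toReal : EReal) = cost f g w := fun hw => by
    rw [toReal_cost hg_proper hw, ← cost_eq_coe hg_proper hw]
  obtain ⟨a, b, c, ha, hb, hc, hdesc, hstep, hsub⟩ := R.exists_estimates S hlev hβ0 hβ1 hD hd
  obtain ⟨r, hr⟩ := R.exists_ball S hlev hβ0 hβ1 hD hd
  -- The values decrease to a limit because the cost is bounded below by its minimum.
  obtain ⟨Φ, hΦ⟩ : ∃ Φ, Tendsto R.value atTop (𝓝 Φ) := by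
    obtain ⟨w, hw⟩ := hsol
    have hwt : g w ≠ ⊤ := by
      intro htop
      have h1 := hw (R.z 0)
      rw [cost, htop, EReal.coe_add_top, ← hcoe (hzt 0), top_le_iff] at h1
      exact EReal.coe_ne_top _ h1
    refine ⟨_, tendsto_atTop_ciInf (R.value_antitone S) ⟨(cost f g w).toReal, ?_⟩⟩
    rintro _ ⟨k, rfl⟩
    have h1 := hw (R.z k)
    rwa [← hcoe (hzt k), ← hcoe hwt, EReal.coe_le_coe_iff] at h1
  set e : ℕ → ℝ := fun k => R.value k - Φ with he
  have he0 : ∀ k, 0 ≤ e k := fun k => sub_nonneg.2 ((R.value_antitone S).le_of_tendsto hΦ k)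
  have hlim : Tendsto e atTop (𝓝 0) := by simpa [he] using hΦ.sub_const Φ
  have hdesc' : ∀ k, e (k + 1) + a * R.increment k ^ 2 ≤ e k := fun k => by
    simp only [he]
    linarith [hdesc k]
  have hΔ0 : ∀ k, 0 ≤ R.increment k := fun k => Real.sqrt_nonneg _
  have hsublim : Tendsto (fun k => R.subgrad (k + 1)) atTop (𝓝 0) := by
    have h1 : Tendsto (fun k => c * (√(e k) / √a)) atTop (𝓝 0) := by
      simpa using ((hlim.sqrt).div_const (√a)).const_mul c
    exact squeeze_zero_norm (fun k => (hsub k).trans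
      (mul_le_mul_of_nonneg_left (increment_le_sqrt ha he0 hdesc' k) hc)) h1
  obtain ⟨zs, -, ψ, hψ, hψz⟩ := (isCompact_closedBall (0 : E n) r).tendsto_subseq
    (x := fun k => R.z (k + 1)) fun k => (hr (k + 1)).1
  have hψ' := hψ.tendsto_atTop
  obtain ⟨hzs, hval, hstat⟩ := R.stationary_of_tendsto S (ψ := fun j => ψ j + 1) hψz
    (hΦ.comp ((tendsto_add_atTop_nat 1).comp hψ')) (hsublim.comp hψ')
  obtain ⟨η, ε, ρ, hη, hε, hρ, hKL'⟩ := hKL zs ⟨0, regSubdiff_subset_subdiff _ _ hstat⟩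
  have hKLe : ∀ k, dist (R.z (k + 1)) zs ≤ ε → 0 < e (k + 1) → e (k + 1) < η →
      e (k + 1) ^ θ ≤ (ρ * (1 - θ) * c) * R.increment k := by
    intro k hk1 hk2 hk3
    have h1 := hKL' (R.z (k + 1)) (by rwa [← dist_eq_norm])
    rw [← hcoe hzs, ← hcoe (hzt (k + 1)), hval, ← EReal.coe_add, EReal.coe_lt_coe_iff,
      EReal.coe_lt_coe_iff, ← EReal.coe_sub, EReal.toReal_coe] at h1
    have h2 := rpow_le_of_kl hρ hθ1 hk2
      (regSubdiff_subset_subdiff _ _ (R.subgrad_mem S (k + 1)))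
      (h1 (sub_pos.1 hk2) (by simp only [he] at hk3; exact sub_lt_iff_lt_add'.1 hk3))
    have h3 : 0 ≤ ρ * (1 - θ) := mul_nonneg hρ.le (by linarith)
    calc e (k + 1) ^ θ ≤ ρ * (1 - θ) * ‖R.subgrad (k + 1)‖ := h2
      _ ≤ ρ * (1 - θ) * (c * R.increment k) := mul_le_mul_of_nonneg_left (hsub k) h3
      _ = _ := by ring
  have hc' : 0 ≤ ρ * (1 - θ) * c := mul_nonneg (mul_nonneg hρ.le (by linarith)) hc
  have hcluster : ∀ δ : ℝ, 0 < δ → ∀ K, ∃ k, K ≤ k ∧ dist (R.z k) zs < δ := by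
    intro δ hδ K
    obtain ⟨j, hj1, hj2⟩ := ((hψz.eventually (Metric.ball_mem_nhds zs hδ)).and
      (hψ'.eventually (eventually_ge_atTop K))).exists
    exact ⟨ψ j + 1, by omega, hj1⟩
  have hz := tendsto_of_kl ha hb hc' hε hη hθ0 hθ1 he0 hΔ0 hdesc' hstep hlim hcluster hKLe
  refine ⟨zs, hz, hstat, fun hθ2 => ?_⟩
  obtain ⟨σ, hσ0, hσ1, hσ⟩ :=
    eventually_contraction_of_kl ha hθ2 hε hη he0 hdesc' hlim hz hKLe
  obtain ⟨M, hM0, hM⟩ := eventually_dist_le_sqrt ha hb hσ0 hσ1 he0 hdesc' hstep hlim hz hσ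
  refine ⟨?_, fun k => ?_, ?_⟩
  · refine rLinear_of_eventually (w := fun k => M * √(e k)) (Real.sqrt_pos.2 hσ0)
      (by rw [Real.sqrt_lt' one_pos]; simpa using hσ1) (fun k => by positivity) ?_ hM
    filter_upwards [hσ] with k hk
    have h1 : √(e (k + 1)) ≤ √σ * √(e k) := by
      rw [← Real.sqrt_mul hσ0.le]
      exact Real.sqrt_le_sqrt hk
    calc M * √(e (k + 1)) ≤ M * (√σ * √(e k)) := mul_le_mul_of_nonneg_left h1 hM0
      _ = √σ * (M * √(e k)) := by ring
  · rw [← hcoe (hzt k)]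
    exact ⟨EReal.coe_ne_top _, EReal.coe_ne_bot _⟩
  · refine rLinear_of_eventually hσ0 hσ1 he0 hσ (Eventually.of_forall fun k => ?_)
    rw [hval, Real.dist_eq]
    exact (abs_of_nonneg (he0 k)).le
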